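/- Let $k$ be an algebraically closed field of characteristic $p>2$, let $r\ge 3$, and let $x_1,\dots,x_{r-1}\in k$ and $x_r=\infty$ be distinct points of $X=\mathbb P^1_k$ (the marked points). Write $D=\partial/\partial t$, $f'=D(f)$. **Signature.** Let $M\subset\mathbb P^1(k)$ be a finite set and let $\sigma_x\in\frac1{p-1}\mathbb Z$ $(x\in M)$ satisfy $\sigma_x\ge 0$ and $\sigma_x\ne 1,\frac{p+1}{p-1}$, such that $d=\frac{p-1}{2}\bigl(-2-\sum_{x\in M}(\sigma_x-1)\bigr)$ is a positive integer, and such that $\{x\in M:\sigma_x\not\equiv 1 \bmod p\}=\{x_1,\dots,x_r\}$. Put $\sigma_i=\sigma_{x_i}$, let $0\le\alpha_i<p$ be the integer with $\alpha_i\equiv\sigma_i\bmod p$, and put $Q=\prod_{i=1}^{r-1}(t-x_i)^{1-\alpha_i}$. **Bundles.** A flat bundle is a rank two vector bundle $\mathcal E$ on $X$ with a connection $\nabla:\mathcal E\to\mathcal E\otimes\Omega^{\log}$, where $\Omega^{\log}=\Omega_{X/k}(\sum x_i)$. It is *indigenous* if it has a line subbundle $F^1\mathcal E$ with locally free quotient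 (the Hodge filtration) whose Kodaira–Spencer map $F^1\mathcal E\to(\mathcal E/F^1\mathcal E)\otimes\Omega^{\log}$ is an isomorphism, and if its residue endomorphism on the fibre at each $x_i$ is nonzero. Its $p$-curvature is $\Psi(\theta^{\otimes p})=\nabla(\theta)^p-\nabla(\theta^p)$, for rational vector fields $\theta$; $\mathcal E$ is *active* if $\Psi\neq0$, *nilpotent* if all endomorphisms $\Psi(\theta^{\otimes p})$ are nilpotent, and *normalized* if there is a surjective horizontal $\gamma:\mathcal E\to\mathcal O_X$. Then the *canonical section* $e_0$ is the rational section of $F^1\mathcal E$ with $\gamma(e_0)=1$, and the *supersingular points* are the points where $e_0$ has a simple pole. Write $\nabla(D)e_0=-v\,\Psi(D^{\otimes p})e_0$ with $v\in k(t)$. The associated deformation datum is the cover $z^{p-1}=v^{-1}$ with the differential $\omega=z\,dt$; its invariants $\sigma_x(\mathcal E)$ are given by $(p-1)(1-\sigma_x(\mathcal E))=\operatorname{ord}_x\bigl(v\,D^{\otimes(p-1)}\bigr)$ (order of a rational section of $(\Omega_{X/k})^{\otimes(1-p)}$), and the *signature* of $\mathcal E$ is the family of the $\sigma_x(\mathcal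 E)$ over the points with $\sigma_x(\mathcal E)\ne1,\frac{p+1}{p-1}$. The *operator associated to* $(\mathcal E,\nabla)$ is $D^2+p_1D+p_2$, where $e_1$ is a section of $F^1\mathcal E$ that is invertible on $\mathbb A^1$ and $\nabla(D)^2e_1=-p_2e_1-p_1\nabla(D)e_1$. **Proposition.** Let $L=D^2+p_1D+p_2$ with $p_1,p_2\in k(t)$ regular outside the marked points, with regular singularities at the $x_i$ and local exponents $(\alpha_i,0)$ at $x_i$ for $i<r$ and $(-d+\alpha_r,-d)$ at $x_r=\infty$. Suppose that $L(u)=0$ for a polynomial $u\in k[t]$ of degree $d$ with simple zeros, such that 1. $u(x_i)\neq 0$ for $i=1,\dots,r-1$; 2. for every $x\in\mathbb A^1(k)$, the rational function $f=D^{p-1}\bigl(\frac1{Qu^2}\bigr)$ satisfies $$\operatorname{ord}_x f=\begin{cases}0&\text{if }u(x)=0,\\(p-1)\sigma_i+\alpha_i-p&\text{if }x=x_i,\\(p-1)(\sigma_x-1)&\text{if }x\in M\setminus\{x_1,\dots,x_r\},\\0&\text{otherwise}\end{cases}$$ (in particular $f\ne0$, and no zero of $u$ lies in $M$). Then $L$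 is associated to an indigenous bundle $(\mathcal E,\nabla)$ on $(X;x_1,\dots,x_r)$ which is active, nilpotent and normalized; its signature is $(\sigma_x)_{x\in M}$, and its supersingular points are exactly the zeros of $u$. -/

import Mathlib

open Polynomial OnePoint

noncomputable section

namespace ProjLine

variable {k : Type*} [Field k]

/-! ### The derivation `d/dt` of `k(t)` -/

/-- The underlying function of `d/dt`: the quotient rule applied to the reduced fraction. -/
def ddtFun (f : RatFunc k) : RatFunc k :=
  (algebraMap k[X] (RatFunc k) (derivative f.num) * algebraMap k[X] (RatFunc k) f.denom
    - algebraMap k[X] (RatFunc k) f.num * algebraMap k[X] (RatFunc k) (derivative f.denom))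
    / algebraMap k[X] (RatFunc k) f.denom ^ 2

theorem ddtFun_div (a b : k[X]) (hb : b ≠ 0) :
    ddtFun (algebraMap k[X] (RatFunc k) a / algebraMap k[X] (RatFunc k) b) =
      (algebraMap k[X] (RatFunc k) (derivative a) * algebraMap k[X] (RatFunc k) b
        - algebraMap k[X] (RatFunc k) a * algebraMap k[X] (RatFunc k) (derivative b))
        / algebraMap k[X] (RatFunc k) b ^ 2 := by
  set f : RatFunc k := algebraMap k[X] (RatFunc k) a / algebraMap k[X] (RatFunc k) b with hf
  have hn : f.denom ≠ 0 := f.denom_ne_zero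
  have hB : algebraMap k[X] (RatFunc k) b ≠ 0 := RatFunc.algebraMap_ne_zero hb
  have hN : algebraMap k[X] (RatFunc k) f.denom ≠ 0 := RatFunc.algebraMap_ne_zero hn
  have h1 : f.num * b = a * f.denom := by
    apply RatFunc.algebraMap_injective k
    have h2 := RatFunc.num_div_denom f
    rw [hf] at h2
    rw [← hf, div_eq_div_iff hN hB] at h2
    simpa only [map_mul] using h2
  have h3 : derivative f.num * b + f.num * derivative b
      = derivative a * f.denom + a * derivative f.denom := by
    rw [← derivative_mul, ← derivative_mul, h1]
  have h1' := congrArg (algebraMap k[X] (RatFunc k)) h1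
  have h3' := congrArg (algebraMap k[X] (RatFunc k)) h3
  simp only [map_mul, map_add] at h1' h3'
  unfold ddtFun
  rw [div_eq_div_iff (pow_ne_zero 2 hN) (pow_ne_zero 2 hB)]
  linear_combination
    (algebraMap k[X] (RatFunc k) f.denom * algebraMap k[X] (RatFunc k) b) * h3'
    - (algebraMap k[X] (RatFunc k) (derivative b) * algebraMap k[X] (RatFunc k) f.denom
      + algebraMap k[X] (RatFunc k) (derivative f.denom) * algebraMap k[X] (RatFunc k) b) * h1'

theorem ddtFun_algebraMap (a : k[X]) :
    ddtFun (algebraMap k[X] (RatFunc k) a) = algebraMap k[X] (RatFunc k) (derivative a) := by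
  have h := ddtFun_div a 1 one_ne_zero
  simpa using h

theorem ddtFun_add (f g : RatFunc k) : ddtFun (f + g) = ddtFun f + ddtFun g := by
  have hf : algebraMap k[X] (RatFunc k) f.denom ≠ 0 :=
    RatFunc.algebraMap_ne_zero f.denom_ne_zero
  have hg : algebraMap k[X] (RatFunc k) g.denom ≠ 0 :=
    RatFunc.algebraMap_ne_zero g.denom_ne_zero
  have h : f + g = algebraMap k[X] (RatFunc k) (f.num * g.denom + f.denom * g.num)
      / algebraMap k[X] (RatFunc k) (f.denom * g.denom) := by
    conv_lhs => rw [← RatFunc.num_div_denom f, ← RatFunc.num_div_denom g]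
    rw [div_add_div _ _ hf hg]
    simp only [map_add, map_mul]
  rw [h, ddtFun_div _ _ (mul_ne_zero f.denom_ne_zero g.denom_ne_zero)]
  unfold ddtFun
  simp only [map_add, derivative_mul, map_mul]
  field_simp
  ring

theorem ddtFun_mul (f g : RatFunc k) : ddtFun (f * g) = f * ddtFun g + g * ddtFun f := by
  have hf : algebraMap k[X] (RatFunc k) f.denom ≠ 0 :=
    RatFunc.algebraMap_ne_zero f.denom_ne_zero
  have hg : algebraMap k[X] (RatFunc k) g.denom ≠ 0 :=
    RatFunc.algebraMap_ne_zero g.denom_ne_zero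
  have h : f * g = algebraMap k[X] (RatFunc k) (f.num * g.num)
      / algebraMap k[X] (RatFunc k) (f.denom * g.denom) := by
    conv_lhs => rw [← RatFunc.num_div_denom f, ← RatFunc.num_div_denom g]
    rw [div_mul_div_comm]
    simp only [map_mul]
  have key : f * ddtFun g + g * ddtFun f =
      (algebraMap k[X] (RatFunc k) f.num / algebraMap k[X] (RatFunc k) f.denom) * ddtFun g
      + (algebraMap k[X] (RatFunc k) g.num / algebraMap k[X] (RatFunc k) g.denom)
        * ddtFun f := by
    rw [RatFunc.num_div_denom, RatFunc.num_div_denom]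
  rw [key, h, ddtFun_div _ _ (mul_ne_zero f.denom_ne_zero g.denom_ne_zero)]
  unfold ddtFun
  simp only [derivative_mul, map_add, map_mul]
  field_simp
  ring

/-- The derivation `D = d/dt` of the rational function field `k(t)` over `k`. -/
def ddt : Derivation k (RatFunc k) (RatFunc k) :=
  Derivation.mk'
    { toFun := ddtFun
      map_add' := ddtFun_add
      map_smul' := by
        intro c f
        have hc : ddtFun (algebraMap k[X] (RatFunc k) (C c)) = 0 := by
          rw [ddtFun_algebraMap, derivative_C, map_zero]
        have h : ∀ g : RatFunc k, c • g = algebraMap k[X] (RatFunc k) (C c) * g := by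
          intro g
          rw [Algebra.smul_def]
          rfl
        simp only [RingHom.id_apply]
        rw [h, h, ddtFun_mul, hc, mul_zero, add_zero] }
    (by
      intro f g
      exact ddtFun_mul f g)

theorem ddt_algebraMap (a : k[X]) :
    ddt (algebraMap k[X] (RatFunc k) a) = algebraMap k[X] (RatFunc k) (derivative a) :=
  ddtFun_algebraMap a

/-! ### Places of `ℙ¹`

Closed points of `ℙ¹` over an algebraically closed field `k` are the elements of
`OnePoint k = k ∪ {∞}`. -/

/-- The prime `(t - a)` of `k[t]`. -/
def pointIdeal (a : k) : IsDedekindDomain.HeightOneSpectrum k[X] where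
  asIdeal := Ideal.span {X - C a}
  isPrime := (Ideal.span_singleton_prime (X_sub_C_ne_zero a)).2 (prime_X_sub_C a)
  ne_bot := by
    rw [Ne, Ideal.span_singleton_eq_bot]
    exact X_sub_C_ne_zero a

open Classical in
/-- The valuation of `k(t)` at a closed point of `ℙ¹`, written multiplicatively:
its value at `f` is `exp (-n)` for `n = ord_x f`, and `0` for `f = 0`. -/
def val : OnePoint k → Valuation (RatFunc k) (WithZero (Multiplicative ℤ))
  | ∞ => RatFunc.inftyValuation k
  | OnePoint.some a => (pointIdeal a).valuation (RatFunc k)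

/-- `ord_x f = n`. This is false for `f = 0`, whatever `n` is. -/
def OrdEq (x : OnePoint k) (f : RatFunc k) (n : ℤ) : Prop :=
  val x f = WithZero.exp (-n)

/-- `f` is regular at `x` with value `c`. -/
def HasValue (x : OnePoint k) (f : RatFunc k) (c : k) : Prop :=
  val x (f - RatFunc.C c) < 1

/-- The local ring `𝒪_{ℙ¹,x}`, as a subring of `k(t)`. -/
abbrev localRing (x : OnePoint k) : Subring (RatFunc k) := (val x).integer

open Classical in
/-- With `S` the set of marked points, `logGen S x • d/dt` generates near `x` the sheaf of vector
fields on `ℙ¹` that have at least simple zeros in the points of `S`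
(near `∞` the field `d/dt` is, up to sign, `s² d/ds` for `s = 1/t`). -/
def logGen (S : Finset (OnePoint k)) : OnePoint k → RatFunc k
  | ∞ => if ∞ ∈ S then RatFunc.X else RatFunc.X ^ 2
  | OnePoint.some a => if (a : OnePoint k) ∈ S then RatFunc.X - RatFunc.C a else 1

/-! ### Flat vector bundles of rank two -/

/-- A flat vector bundle of rank two on `ℙ¹` with regular singularities in the marked points `S`.
The vector bundle is given by its generic fibre, identified with `k(t)²`, and its stalks: free
`𝒪_x`-lattices that are spanned by one and the same basis of `k(t)²` for almost all `x`.
The connection is given by `nabla = ∇(d/dt)`, so that `∇(h d/dt) = h ∇(d/dt)`;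
`log_regular` says that `∇` maps sections to sections with at most logarithmic poles along `S`. -/
structure FlatBundle (S : Finset (OnePoint k)) where
  stalk : ∀ x : OnePoint k, Submodule (localRing x) (Fin 2 → RatFunc k)
  locally_free : ∀ x, ∃ b : Module.Basis (Fin 2) (RatFunc k) (Fin 2 → RatFunc k),
    stalk x = Submodule.span (localRing x) (Set.range b)
  coherent : ∃ b : Module.Basis (Fin 2) (RatFunc k) (Fin 2 → RatFunc k),
    ∀ᶠ x in Filter.cofinite, stalk x = Submodule.span (localRing x) (Set.range b)
  nabla : (Fin 2 → RatFunc k) →ₗ[k] (Fin 2 → RatFunc k)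
  leibniz : ∀ (f : RatFunc k) (e : Fin 2 → RatFunc k),
    nabla (f • e) = ddt f • e + f • nabla e
  log_regular : ∀ x, ∀ e ∈ stalk x, logGen S x • nabla e ∈ stalk x

namespace FlatBundle

variable {S : Finset (OnePoint k)} (E : FlatBundle S)

/-- The submodule `𝔪_x · E_x` of the stalk at `x`. -/
def maxStalk (x : OnePoint k) : Submodule (localRing x) (Fin 2 → RatFunc k) :=
  Submodule.span (localRing x)
    {e | ∃ f : RatFunc k, val x f < 1 ∧ ∃ e' ∈ E.stalk x, e = f • e'}

/-- The connection has nontrivial monodromy at the marked point `x`: the endomorphism of the fibre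
`E_x / 𝔪_x E_x` induced by `∇(t ∂/∂t)`, for a local parameter `t`, is nonzero. -/
def NontrivialMonodromy (x : OnePoint k) : Prop :=
  ∃ e ∈ E.stalk x, logGen S x • E.nabla e ∉ E.maxStalk x

/-- The stalk at `x` of the saturated subbundle with generic fibre `F`. Line subbundles whose
quotient is a line bundle correspond to one-dimensional subspaces `F` of the generic fibre. -/
def filStalk (F : Submodule (RatFunc k) (Fin 2 → RatFunc k)) (x : OnePoint k) :
    Submodule (localRing x) (Fin 2 → RatFunc k) :=
  F.restrictScalars (localRing x) ⊓ E.stalk x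

/-- The Kodaira--Spencer map `F¹E → E / F¹E ⊗ Ω^log` on stalks at `x`, where `Ω^log` is
trivialized by the dual of the generator `logGen S x • d/dt`. -/
def kodairaSpencer (F : Submodule (RatFunc k) (Fin 2 → RatFunc k)) (x : OnePoint k) :
    E.filStalk F x →ₗ[localRing x]
      (E.stalk x ⧸ (E.filStalk F x).submoduleOf (E.stalk x)) where
  toFun e := Submodule.Quotient.mk
    ⟨logGen S x • E.nabla (e : Fin 2 → RatFunc k), E.log_regular x e e.2.2⟩
  map_add' a b := by
    rw [← Submodule.Quotient.mk_add]
    congr 1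
    ext1
    simp only [Submodule.coe_add, map_add, smul_add]
  map_smul' f a := by
    rw [RingHom.id_apply, ← Submodule.Quotient.mk_smul, Submodule.Quotient.eq]
    have hEq : logGen S x • E.nabla ((f : RatFunc k) • (a : Fin 2 → RatFunc k))
        - (f : RatFunc k) • logGen S x • E.nabla (a : Fin 2 → RatFunc k)
        = (logGen S x * ddt (f : RatFunc k)) • (a : Fin 2 → RatFunc k) := by
      rw [E.leibniz, smul_add, smul_smul, smul_comm (f : RatFunc k), add_sub_cancel_right]
    have hF : logGen S x • E.nabla ((f : RatFunc k) • (a : Fin 2 → RatFunc k))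
        - (f : RatFunc k) • logGen S x • E.nabla (a : Fin 2 → RatFunc k) ∈ F := by
      rw [hEq]
      exact F.smul_mem _ a.2.1
    exact ⟨hF, Submodule.sub_mem _ (E.log_regular x _ (f • a).2.2)
      ((E.stalk x).smul_mem f (E.log_regular x _ a.2.2))⟩

/-- `F` is (the generic fibre of) a Hodge filtration of `E`. -/
def IsHodgeFiltration (F : Submodule (RatFunc k) (Fin 2 → RatFunc k)) : Prop :=
  Module.finrank (RatFunc k) F = 1 ∧ ∀ x, Function.Bijective (E.kodairaSpencer F x)

/-- `E` is an indigenous bundle on `ℙ¹` marked by `S`. -/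
def IsIndigenous : Prop :=
  (∃ F, E.IsHodgeFiltration F) ∧ ∀ x ∈ S, E.NontrivialMonodromy x

/-- The value `Ψ(θ^{⊗p}) = ∇(θ)^p - ∇(θ^p)` of the `p`-curvature at `θ = h d/dt`. Here `θ^p` is the
derivation `θ^p(t) d/dt` of `k(t)`. -/
def pCurvature (p : ℕ) (h : RatFunc k) : Module.End k (Fin 2 → RatFunc k) :=
  (h • E.nabla) ^ p - ((fun f => h * ddt f)^[p] RatFunc.X) • E.nabla

/-- The `p`-curvature is not zero. -/
def IsActive (p : ℕ) : Prop := ∃ h, E.pCurvature p h ≠ 0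

/-- The image of the `p`-curvature consists of nilpotent endomorphisms. -/
def HasNilpotentPCurvature (p : ℕ) : Prop := ∀ h, IsNilpotent (E.pCurvature p h)

/-- `γ` is (generically) a horizontal and surjective homomorphism `E → 𝒪`. -/
def IsNormalization (γ : (Fin 2 → RatFunc k) →ₗ[RatFunc k] RatFunc k) : Prop :=
  (∀ e, γ (E.nabla e) = ddt (γ e)) ∧
    ∀ x, γ '' (E.stalk x : Set (Fin 2 → RatFunc k)) = (localRing x : Set (RatFunc k))

/-- `E` is normalized. -/
def IsNormalized : Prop := ∃ γ, E.IsNormalization γ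

/-- `e₀` is the canonical section attached to the Hodge filtration `F` and to `γ`: the rational
section of `F` with `γ(e₀) = 1`. -/
def IsCanonicalSection (F : Submodule (RatFunc k) (Fin 2 → RatFunc k))
    (γ : (Fin 2 → RatFunc k) →ₗ[RatFunc k] RatFunc k) (e₀ : Fin 2 → RatFunc k) : Prop :=
  E.IsHodgeFiltration F ∧ E.IsNormalization γ ∧ e₀ ∈ F ∧ γ e₀ = 1

/-- The rational section `e` of `E` has a simple pole at `x`. -/
def HasSimplePole (e : Fin 2 → RatFunc k) (x : OnePoint k) : Prop :=
  e ∉ E.stalk x ∧ ∃ π : RatFunc k, OrdEq x π 1 ∧ π • e ∈ E.stalk x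

/-- `L = (d/dt)² + p₁ d/dt + p₂` is the differential operator associated to `E` with Hodge
filtration `F`: for a section `e₁` of `F` that is invertible on all of `𝔸¹`, and
`e₂ = ∇(d/dt) e₁`, one has `∇(d/dt) e₂ = - p₂ e₁ - p₁ e₂`. -/
def IsAssociatedOperator (F : Submodule (RatFunc k) (Fin 2 → RatFunc k))
    (p₁ p₂ : RatFunc k) : Prop :=
  ∃ e₁ : Fin 2 → RatFunc k,
    (∀ a : k, E.filStalk F (a : OnePoint k) = Submodule.span (localRing (a : OnePoint k)) {e₁}) ∧
    E.nabla (E.nabla e₁) = -(p₂ • e₁) - p₁ • E.nabla e₁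

end FlatBundle

/-! ### Signatures -/

/-- A signature whose finite index set `M` is a set of points of `ℙ¹` (genus `0`). The rational
number attached to `x ∈ M` is `σ_x = num x / (p - 1)`; `num` is only relevant on `M`. -/
structure Signature (k : Type*) (p : ℕ) where
  M : Finset (OnePoint k)
  num : OnePoint k → ℤ
  nonneg : ∀ x ∈ M, 0 ≤ num x
  ne_one : ∀ x ∈ M, num x ≠ (p : ℤ) - 1
  ne_ss : ∀ x ∈ M, num x ≠ (p : ℤ) + 1
  /-- the number `d = (p - 1) / 2 * (-2 - ∑ (σ_x - 1))`, required to be a positive integer -/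
  d : ℕ
  d_pos : 0 < d
  two_mul_d : 2 * (d : ℤ) = ((p : ℤ) - 1) * (-2) - ∑ x ∈ M, (num x - ((p : ℤ) - 1))

/-- `x` is a singularity of `σ`: it lies in `M` and `σ_x ≢ 1 mod p`. -/
def Signature.IsSingularity {p : ℕ} (σ : Signature k p) (x : OnePoint k) : Prop :=
  x ∈ σ.M ∧ ¬ σ.num x ≡ (p : ℤ) - 1 [ZMOD p]

/-- `φ = v • (d/dt)^{⊗ n}`, as a rational section of the `n`-th power of the (ordinary) tangent
bundle of `ℙ¹`, has order `m` at `x`. -/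
def TensorOrdEq (x : OnePoint k) (v : RatFunc k) (n : ℕ) (m : ℤ) : Prop :=
  OrdEq x (v / logGen (∅ : Finset (OnePoint k)) x ^ n) m

/-- The signature of the (active, nilpotent, normalized, indigenous) bundle `E` with canonical
section `e₀` is `σ`.

The deformation datum `(Z, ω)` of `E` is given by `φ₀ = ∇(e₀) = ω^{⊗(1-p)}`. Explicitly,
`φ₀ = v (d/dt)^{⊗(p-1)}` where `∇(d/dt) e₀ = v • δ` and `δ = -Ψ((d/dt)^{⊗p}) e₀` is the image of
`(d/dt)^{⊗p}` in `E`; then `Z` is the cover `z^{p-1} = v⁻¹`, `ω = z dt`, and the invariant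
`σ_x = (ord_z ω + 1) / |H_z|` of `(Z, ω)` is given by `(p-1)(1-σ_x) = ord_x φ₀`.
In the definition `n = (p-1) σ_x`. The signature of `(Z, ω)` is the family of the `σ_x` over the
points `x` with `σ_x ≠ 1, (p+1)/(p-1)`. -/
def FlatBundle.HasSignature {S : Finset (OnePoint k)} (E : FlatBundle S) (p : ℕ)
    (e₀ : Fin 2 → RatFunc k) (σ : Signature k p) : Prop :=
  ∃ v : RatFunc k, E.nabla e₀ = v • (-(E.pCurvature p 1 e₀)) ∧
    ∀ x, ∃ n : ℤ, TensorOrdEq x v (p - 1) ((p : ℤ) - 1 - n) ∧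
      (x ∈ σ.M → n = σ.num x) ∧
      (x ∉ σ.M → n = (p : ℤ) - 1 ∨ n = (p : ℤ) + 1)

/-! ### Second order operators -/

/-- `L = (d/dt)² + p₁ d/dt + p₂` has a regular singularity at the finite point `a`, with local
exponents `ρ₁, ρ₂` (the roots of the indicial polynomial). -/
def RegularSingularAt (p₁ p₂ : RatFunc k) (a ρ₁ ρ₂ : k) : Prop :=
  ∃ A B : k, HasValue (a : OnePoint k) ((RatFunc.X - RatFunc.C a) * p₁) A ∧
    HasValue (a : OnePoint k) ((RatFunc.X - RatFunc.C a) ^ 2 * p₂) B ∧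
    (X * (X - 1) + C A * X + C B : k[X]) = (X - C ρ₁) * (X - C ρ₂)

/-- `L = (d/dt)² + p₁ d/dt + p₂` has a regular singularity at `∞`, with local exponents `ρ₁, ρ₂`
with respect to the local parameter `1/t`. -/
def RegularSingularAtInfty (p₁ p₂ : RatFunc k) (ρ₁ ρ₂ : k) : Prop :=
  ∃ A B : k, HasValue ∞ (RatFunc.X * p₁) A ∧
    HasValue ∞ (RatFunc.X ^ 2 * p₂) B ∧
    (X * (X + 1) - C A * X + C B : k[X]) = (X - C ρ₁) * (X - C ρ₂)

/-- The rational function `Q = ∏ (t - x_i)^{1 - α_i}`, the product over the finite marked points. -/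
def Qfun (T : Finset k) (α : OnePoint k → ℕ) : RatFunc k :=
  ∏ a ∈ T, (RatFunc.X - RatFunc.C a) ^ (1 - (α (a : OnePoint k) : ℤ))

/-- The rational function `D^{p-1}(1 / (Q u²))`. -/
def dualFun (p : ℕ) (T : Finset k) (α : OnePoint k → ℕ) (u : k[X]) : RatFunc k :=
  (fun f => ddt f)^[p - 1] (1 / (Qfun T α * (algebraMap k[X] (RatFunc k) u) ^ 2))

open Classical in
/-- The set of marked points: the finite points `T` together with `∞`. -/
def marked (T : Finset k) : Finset (OnePoint k) :=
  insert ∞ (T.image (fun a : k => (a : OnePoint k)))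

end ProjLine

end

namespace ProjLine

variable {k : Type*} [Field k]

/-! ### Valuations -/

local notation "ι" => algebraMap k[X] (RatFunc k)

/-! The bundle is the companion system of `L`: a rank two space over `k(t)` with basis `e₁`, `e₂`,
where `∇(D)e₁ = e₂` and `∇(D)e₂ = -p₂e₁ - p₁e₂`. Its stalk at `x` is spanned by `s e₁` and `s g e₂`,
with `g = logGen S x`, `s = 1` on the affine line and `s = t^{-d}` at infinity. Regular
singularities say that `g p₁` and `g² p₂` are regular, which makes the connection logarithmic.
Modulo `e₁` the field `g D` sends `s e₁` to `s g e₂`, so the Kodaira–Spencer map of the line `⟨e₁⟩`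
is an isomorphism and every residue is nonzero (`isHodgeFiltration`, `nontrivialMonodromy`).

The solution `u` gives the functional `γ(e₁) = u`, `γ(e₂) = u'`, which is horizontal because `L(u) =
0`. It is surjective because `t^{-d}u` is a unit at infinity and `u`, `u'` have no common zero
(`isNormalization`). Hence `e₀ = e₁/u`, with poles exactly at the zeros of `u`.

The exponents `(α_i, 0)` fix the residues of `p₁` at the finite marked points, so `p₁ = Q'/Q`
(`ddt_Qfun`). Therefore `δ = -Qu'e₁ + Qu e₂` is horizontal; it spans `ker γ`, and `∇(D)e₀ =
(1/(Qu²)) δ`. As `D^p = 0`, applying `∇(D)` another `p-1` times gives `Ψ(D^{⊗p})e₀ = f δ` with `f =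
D^{p-1}(1/(Qu²))`. So `f ≠ 0` gives activity, while `Ψ` maps into `ker γ` and kills it, which gives
nilpotence.

Finally `v = -1/(Qu²f)`. Its finite orders are read off from those of `Q`, `u` and `f`. The order at
infinity follows since a rational function has degree zero, and the defining equation of `d` makes
it the required one. -/

theorem val_coe (a : k) : val (a : OnePoint k) = (pointIdeal a).valuation (RatFunc k) := rfl

theorem val_coe_algebraMap_le_one (a : k) (q : k[X]) : val (a : OnePoint k) (ι q) ≤ 1 :=
  (pointIdeal a).valuation_le_one q

theorem val_coe_algebraMap_lt_one_iff (a : k) (q : k[X]) :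
    val (a : OnePoint k) (ι q) < 1 ↔ q.IsRoot a := by
  rw [val_coe, IsDedekindDomain.HeightOneSpectrum.valuation_lt_one_iff_mem,
    ← dvd_iff_isRoot]
  exact Ideal.mem_span_singleton

theorem val_coe_algebraMap_eq_one {a : k} {q : k[X]} (h : ¬ q.IsRoot a) :
    val (a : OnePoint k) (ι q) = 1 :=
  le_antisymm (val_coe_algebraMap_le_one a q)
    (not_lt.1 fun h' => h ((val_coe_algebraMap_lt_one_iff a q).1 h'))

theorem X_sub_C_eq_algebraMap (a : k) : (RatFunc.X - RatFunc.C a : RatFunc k) = ι (X - C a) := by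
  rw [map_sub, RatFunc.algebraMap_X, RatFunc.algebraMap_C]

theorem X_sub_C_ne_zero' (a : k) : (RatFunc.X - RatFunc.C a : RatFunc k) ≠ 0 := by
  rw [X_sub_C_eq_algebraMap]
  exact RatFunc.algebraMap_ne_zero (X_sub_C_ne_zero a)

theorem val_coe_X_sub_C (a : k) :
    val (a : OnePoint k) (RatFunc.X - RatFunc.C a) = WithZero.exp (-1) := by
  rw [X_sub_C_eq_algebraMap, val_coe, IsDedekindDomain.HeightOneSpectrum.valuation_of_algebraMap]
  exact (pointIdeal a).intValuation_singleton (X_sub_C_ne_zero a) rfl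

theorem val_coe_X_sub_C_of_ne {a b : k} (h : a ≠ b) :
    val (a : OnePoint k) (RatFunc.X - RatFunc.C b) = 1 := by
  rw [X_sub_C_eq_algebraMap]
  exact val_coe_algebraMap_eq_one (by simpa [sub_eq_zero] using h)

theorem val_infty_algebraMap {q : k[X]} (hq : q ≠ 0) :
    val ∞ (ι q) = WithZero.exp (q.natDegree : ℤ) := by
  classical exact RatFunc.inftyValuation.polynomial k hq

theorem val_infty_X : val ∞ (RatFunc.X : RatFunc k) = WithZero.exp 1 := by
  classical exact RatFunc.inftyValuation.X k

theorem val_infty_X_sub_C (a : k) :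
    val ∞ (RatFunc.X - RatFunc.C a) = WithZero.exp 1 := by
  rw [X_sub_C_eq_algebraMap, val_infty_algebraMap (X_sub_C_ne_zero a), natDegree_X_sub_C]
  rfl

theorem val_C {c : k} (hc : c ≠ 0) (x : OnePoint k) : val x (RatFunc.C c) = 1 := by
  have h : (RatFunc.C c : RatFunc k) = ι (C c) := (RatFunc.algebraMap_C c).symm
  rw [h]
  induction x using OnePoint.rec with
  | infty => rw [val_infty_algebraMap (C_ne_zero.2 hc), natDegree_C]; rfl
  | coe a => exact val_coe_algebraMap_eq_one (by simpa using hc)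

theorem val_C_le_one (c : k) (x : OnePoint k) : val x (RatFunc.C c) ≤ 1 := by
  by_cases hc : c = 0
  · simp [hc]
  · exact (val_C hc x).le

theorem HasValue.val_le_one {x : OnePoint k} {f : RatFunc k} {c : k} (h : HasValue x f c) :
    val x f ≤ 1 := by
  have := (val x).map_add_le (le_of_lt h) (val_C_le_one c x)
  simpa using this

/-! ### Orders of zeros and poles -/

theorem OrdEq.ne_zero {x : OnePoint k} {f : RatFunc k} {n : ℤ} (h : OrdEq x f n) : f ≠ 0 := by
  rintro rfl
  rw [OrdEq, map_zero] at h
  exact WithZero.exp_ne_zero h.symm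

theorem OrdEq.mul {x : OnePoint k} {f g : RatFunc k} {m n : ℤ} (hf : OrdEq x f m)
    (hg : OrdEq x g n) : OrdEq x (f * g) (m + n) := by
  rw [OrdEq] at *
  rw [map_mul, hf, hg, ← WithZero.exp_add]
  congr 1
  ring

theorem OrdEq.inv {x : OnePoint k} {f : RatFunc k} {m : ℤ} (hf : OrdEq x f m) :
    OrdEq x f⁻¹ (-m) := by
  rw [OrdEq] at *
  rw [map_inv₀, hf, ← WithZero.exp_neg]

theorem OrdEq.div {x : OnePoint k} {f g : RatFunc k} {m n : ℤ} (hf : OrdEq x f m)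
    (hg : OrdEq x g n) : OrdEq x (f / g) (m - n) := by
  rw [div_eq_mul_inv, sub_eq_add_neg]
  exact hf.mul hg.inv

theorem OrdEq.zpow {x : OnePoint k} {f : RatFunc k} {m : ℤ} (hf : OrdEq x f m) (n : ℤ) :
    OrdEq x (f ^ n) (n * m) := by
  rw [OrdEq] at *
  rw [map_zpow₀, hf, ← WithZero.exp_zsmul]
  congr 1
  simp

theorem OrdEq.pow {x : OnePoint k} {f : RatFunc k} {m : ℤ} (hf : OrdEq x f m) (n : ℕ) :
    OrdEq x (f ^ n) (n * m) := by
  simpa using hf.zpow n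

theorem OrdEq.prod {x : OnePoint k} {ι' : Type*} {s : Finset ι'} {f : ι' → RatFunc k} {m : ι' → ℤ}
    (h : ∀ i ∈ s, OrdEq x (f i) (m i)) : OrdEq x (∏ i ∈ s, f i) (∑ i ∈ s, m i) := by
  classical
  induction s using Finset.induction_on with
  | empty => simp [OrdEq]
  | insert a s ha ih =>
    rw [Finset.prod_insert ha, Finset.sum_insert ha]
    exact (h a (by simp)).mul (ih fun i hi => h i (by simp [hi]))

theorem OrdEq.neg {x : OnePoint k} {f : RatFunc k} {m : ℤ} (hf : OrdEq x f m) :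
    OrdEq x (-f) m := by
  rw [OrdEq] at *
  rw [Valuation.map_neg, hf]

theorem OrdEq.unique {x : OnePoint k} {f : RatFunc k} {m n : ℤ} (hm : OrdEq x f m)
    (hn : OrdEq x f n) : m = n := by
  rw [OrdEq] at *
  have := WithZero.exp_injective (hm.symm.trans hn)
  omega

theorem ordEq_zero_iff {x : OnePoint k} {f : RatFunc k} : OrdEq x f 0 ↔ val x f = 1 := by
  simp [OrdEq]

theorem ordEq_coe_X_sub_C_zpow [DecidableEq k] (a b : k) (n : ℤ) :
    OrdEq (a : OnePoint k) ((RatFunc.X - RatFunc.C b) ^ n) (if a = b then n else 0) := by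
  split_ifs with h
  · subst h
    have h1 : OrdEq (a : OnePoint k) (RatFunc.X - RatFunc.C a) 1 := val_coe_X_sub_C a
    simpa using h1.zpow n
  · have h1 : OrdEq (a : OnePoint k) (RatFunc.X - RatFunc.C b) 0 :=
      ordEq_zero_iff.2 (val_coe_X_sub_C_of_ne h)
    simpa using h1.zpow n

theorem ordEq_coe_prod_X_sub_C_zpow [DecidableEq k] (a : k) (s : Finset k) (n : k → ℤ) :
    OrdEq (a : OnePoint k) (∏ b ∈ s, (RatFunc.X - RatFunc.C b) ^ n b)
      (if a ∈ s then n a else 0) := by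
  have := OrdEq.prod (s := s) fun b _ => ordEq_coe_X_sub_C_zpow a b (n b)
  rwa [Finset.sum_ite_eq] at this

theorem ordEq_infty_prod_X_sub_C_zpow (s : Finset k) (n : k → ℤ) :
    OrdEq ∞ (∏ b ∈ s, (RatFunc.X - RatFunc.C b) ^ n b) (- ∑ b ∈ s, n b) := by
  rw [← Finset.sum_neg_distrib]
  refine OrdEq.prod fun b _ => ?_
  have h : OrdEq ∞ (RatFunc.X - RatFunc.C b) (-1) := by
    rw [OrdEq, val_infty_X_sub_C, neg_neg]
  simpa using h.zpow (n b)

theorem ordEq_infty_algebraMap {q : k[X]} (hq : q ≠ 0) : OrdEq ∞ (ι q) (-q.natDegree) := by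
  rw [OrdEq, val_infty_algebraMap hq, neg_neg]

theorem ordEq_infty_X : OrdEq ∞ (RatFunc.X : RatFunc k) (-1) := by
  rw [OrdEq, val_infty_X, neg_neg]

theorem ordEq_coe_algebraMap_of_not_isRoot {a : k} {q : k[X]} (h : ¬ q.IsRoot a) :
    OrdEq (a : OnePoint k) (ι q) 0 :=
  ordEq_zero_iff.2 (val_coe_algebraMap_eq_one h)

theorem not_isRoot_derivative {q : k[X]} (hq : q.Separable) {a : k} (ha : q.IsRoot a) :
    ¬ (derivative q).IsRoot a := by
  intro h
  obtain ⟨c, d, hcd⟩ := hq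
  have := congrArg (eval a) hcd
  simp only [eval_add, eval_mul, ha.eq_zero, h.eq_zero, mul_zero, add_zero, eval_one] at this
  exact zero_ne_one this

theorem ordEq_coe_algebraMap_of_isRoot {q : k[X]} (hq : q.Separable) {a : k} (ha : q.IsRoot a) :
    OrdEq (a : OnePoint k) (ι q) 1 := by
  obtain ⟨r, hr⟩ := dvd_iff_isRoot.2 ha
  have h1 : ¬ r.IsRoot a := by
    intro h
    apply not_isRoot_derivative hq ha
    rw [hr, IsRoot, derivative_mul]
    simp [h.eq_zero]
  rw [hr, map_mul, ← X_sub_C_eq_algebraMap]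
  have h2 : OrdEq (a : OnePoint k) (RatFunc.X - RatFunc.C a) 1 := val_coe_X_sub_C a
  simpa using h2.mul (ordEq_coe_algebraMap_of_not_isRoot h1)

/-- A rational function is regular at `a` only if `a` is not a root of its reduced denominator. -/
theorem not_isRoot_denom {a : k} {f : RatFunc k} (h : val (a : OnePoint k) f ≤ 1) :
    ¬ f.denom.IsRoot a := by
  intro ha
  have hn : ¬ f.num.IsRoot a := by
    intro hn
    obtain ⟨c, d, hcd⟩ := f.isCoprime_num_denom
    have := congrArg (eval a) hcd
    simp [hn.eq_zero, ha.eq_zero] at this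
  have h1 : f * ι f.denom = ι f.num := by
    rw [← eq_div_iff (RatFunc.algebraMap_ne_zero f.denom_ne_zero), RatFunc.num_div_denom]
  have h2 := congrArg (val (a : OnePoint k)) h1
  rw [map_mul, val_coe_algebraMap_eq_one hn] at h2
  have h3 := (val_coe_algebraMap_lt_one_iff a f.denom).2 ha
  exact absurd h2 (mul_lt_one_of_nonneg_of_lt_one_right h zero_le h3).ne

/-- A rational function without finite poles is a polynomial. -/
theorem exists_algebraMap_eq_of_val_le_one [IsAlgClosed k] {f : RatFunc k}
    (h : ∀ a : k, val (a : OnePoint k) f ≤ 1) : ∃ q : k[X], f = ι q := by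
  have hd : f.denom.natDegree = 0 := by
    by_contra hne
    obtain ⟨a, ha⟩ := IsAlgClosed.exists_root f.denom
      (fun h0 => hne (natDegree_eq_of_degree_eq_some h0))
    exact not_isRoot_denom (h a) ha
  have h1 : f.denom = 1 := by
    rw [← f.monic_denom.natDegree_eq_zero]
    exact hd
  refine ⟨f.num, ?_⟩
  conv_lhs => rw [← RatFunc.num_div_denom f, h1]
  simp

/-- A rational function that is regular on `ℙ¹` and vanishes at `∞` is zero. -/
theorem eq_zero_of_val [IsAlgClosed k] {f : RatFunc k}
    (h : ∀ a : k, val (a : OnePoint k) f ≤ 1) (h' : val ∞ f < 1) : f = 0 := by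
  obtain ⟨q, rfl⟩ := exists_algebraMap_eq_of_val_le_one h
  by_contra hne
  have hq : q ≠ 0 := fun h0 => hne (by rw [h0, map_zero])
  rw [val_infty_algebraMap hq, ← WithZero.exp_zero, WithZero.exp_lt_exp] at h'
  omega

/-- A rational function without finite zeros and poles is constant. -/
theorem ordEq_infty_zero [IsAlgClosed k] {f : RatFunc k}
    (h : ∀ a : k, OrdEq (a : OnePoint k) f 0) : OrdEq ∞ f 0 := by
  obtain ⟨q, rfl⟩ := exists_algebraMap_eq_of_val_le_one fun a => (ordEq_zero_iff.1 (h a)).le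
  have hq : q.natDegree = 0 := by
    by_contra hne
    obtain ⟨a, ha⟩ := IsAlgClosed.exists_root q
      (fun h0 => hne (natDegree_eq_of_degree_eq_some h0))
    exact absurd (ordEq_zero_iff.1 (h a)) ((val_coe_algebraMap_lt_one_iff a q).2 ha).ne
  have hq0 : q ≠ 0 := fun h0 => (h 0).ne_zero (by rw [h0, map_zero])
  simpa [hq] using ordEq_infty_algebraMap hq0

/-! ### Derivations -/

theorem ddt_X : ddt (RatFunc.X : RatFunc k) = 1 := by
  rw [← RatFunc.algebraMap_X, ddt_algebraMap, derivative_X, map_one]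

theorem ddt_C (c : k) : ddt (RatFunc.C c : RatFunc k) = 0 := by
  rw [← RatFunc.algebraMap_C, ddt_algebraMap, derivative_C, map_zero]

theorem ddt_X_sub_C (c : k) : ddt (RatFunc.X - RatFunc.C c : RatFunc k) = 1 := by
  rw [map_sub, ddt_X, ddt_C, sub_zero]

/-- In characteristic `p` the `p`-th power of a derivation is a derivation. -/
def _root_.Derivation.powChar {A : Type*} [CommRing A] [Algebra k A] (p : ℕ) [Fact p.Prime]
    [CharP k p] (D : Derivation k A A) : Derivation k A A :=
  Derivation.mk' ((D : A →ₗ[k] A) ^ p) fun a b => by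
    let T : Module.End k A := D
    -- On `A ⊗ A` the operators `D ⊗ 1` and `1 ⊗ D` commute, so the `p`-th power of their sum is the
    -- sum of their `p`-th powers. By the Leibniz rule multiplication intertwines this sum with `D`.
    let L : Module.End k (TensorProduct k A A) := TensorProduct.map T LinearMap.id
    let R : Module.End k (TensorProduct k A A) := TensorProduct.map LinearMap.id T
    have hLR : Commute L R := by
      ext x y
      simp [L, R]
    have hL : ∀ n x y, (L ^ n) (TensorProduct.tmul k x y) = TensorProduct.tmul k ((T ^ n) x) y := by
      intro n
      induction n with
      | zero => intros; simp
      | succ n ih => intro x y; rw [pow_succ, pow_succ]; simp [L]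
    have hR : ∀ n x y, (R ^ n) (TensorProduct.tmul k x y) = TensorProduct.tmul k x ((T ^ n) y) := by
      intro n
      induction n with
      | zero => intros; simp
      | succ n ih => intro x y; rw [pow_succ, pow_succ]; simp [R]
    have hmul : ∀ n w, LinearMap.mul' k A (((L + R) ^ n) w) = (T ^ n) (LinearMap.mul' k A w) := by
      intro n
      induction n with
      | zero => intros; simp
      | succ n ih =>
        intro w
        rw [pow_succ, pow_succ, Module.End.mul_apply, Module.End.mul_apply, ih]
        congr 1
        induction w using TensorProduct.induction_on with
        | zero => simp
        | tmul x y => simp [L, R, T, mul_comm, add_comm]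
        | add x y hx hy => rw [map_add, map_add, hx, hy, map_add, map_add]
    have h := hmul p (TensorProduct.tmul k a b)
    -- Characteristic `p` of the endomorphism ring requires `A ⊗ A` to be nontrivial; otherwise `A`
    -- itself is zero.
    obtain hA | hA := subsingleton_or_nontrivial (TensorProduct k A A)
    · have h0 : ∀ w : TensorProduct k A A, w = 0 := fun w => Subsingleton.elim _ _
      have h1 : ∀ x : A, x = 0 := fun x => by
        simpa using congrArg (LinearMap.mul' k A) (h0 (TensorProduct.tmul k x 1))
      exact (h1 _).trans (h1 _).symm
    · have : CharP (Module.End k (TensorProduct k A A)) p :=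
        charP_of_injective_algebraMap (algebraMap k _).injective p
      rw [add_pow_char_of_commute (R := Module.End k (TensorProduct k A A)) p hLR,
        LinearMap.add_apply, map_add, hL, hR] at h
      simp only [LinearMap.mul'_apply] at h
      rw [smul_eq_mul, smul_eq_mul, mul_comm b, add_comm]
      exact h.symm

theorem _root_.Derivation.powChar_apply {A : Type*} [CommRing A] [Algebra k A] (p : ℕ)
    [Fact p.Prime] [CharP k p] (D : Derivation k A A) (a : A) :
    D.powChar p a = D^[p] a :=
  Module.End.pow_apply _ _ _

/-- A `k`-derivation of `k(t)` is determined by its value at `t`. -/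
theorem derivation_eq_smul_ddt (D : Derivation k (RatFunc k) (RatFunc k)) :
    D = D RatFunc.X • ddt := by
  have h : ∀ q : k[X], D (ι q) = D RatFunc.X * ddt (ι q) := by
    intro q
    rw [ddt_algebraMap]
    induction q using Polynomial.induction_on' with
    | add p q hp hq => rw [map_add, map_add, hp, hq, map_add, map_add, mul_add]
    | monomial n a =>
      rw [← C_mul_X_pow_eq_monomial, derivative_C_mul_X_pow]
      simp only [map_mul (algebraMap k[X] (RatFunc k)), map_pow (algebraMap k[X] (RatFunc k)),
        RatFunc.algebraMap_C, RatFunc.algebraMap_X, Derivation.leibniz, Derivation.leibniz_pow]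
      have hC : D (RatFunc.C a) = 0 := by
        rw [← RatFunc.algebraMap_eq_C]
        exact D.map_algebraMap a
      rw [hC]
      simp only [smul_eq_mul, nsmul_eq_mul, map_mul, map_natCast]
      ring
  ext f
  rw [← RatFunc.num_div_denom f, Derivation.leibniz_div, Derivation.smul_apply,
    Derivation.leibniz_div, h, h]
  simp only [smul_eq_mul]
  ring

/-- `(hD)^p` is again a derivation, hence a multiple of `D`. This is what lets the correction term
`∇(θ^p)` cancel `∇(θ)^p` on horizontal data. -/
theorem iterate_derivation_eq (p : ℕ) [Fact p.Prime] [CharP k p] (h a : RatFunc k) :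
    (fun f => h * ddt f)^[p] a = (fun f => h * ddt f)^[p] RatFunc.X * ddt a := by
  have h1 := derivation_eq_smul_ddt ((h • ddt).powChar p : Derivation k (RatFunc k) (RatFunc k))
  have h2 := DFunLike.congr_fun h1 a
  rw [Derivation.smul_apply, Derivation.powChar_apply, Derivation.powChar_apply] at h2
  exact h2

/-! ### Logarithmic vector fields -/

theorem val_coe_ddt_le_one {a : k} {f : RatFunc k} (h : val (a : OnePoint k) f ≤ 1) :
    val (a : OnePoint k) (ddt f) ≤ 1 := by
  have hd := not_isRoot_denom h
  have h1 : ddt f = ddtFun f := rfl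
  rw [h1, ddtFun, ← map_mul, ← map_mul, ← map_sub, map_div₀, map_pow,
    val_coe_algebraMap_eq_one hd, one_pow, div_one]
  exact val_coe_algebraMap_le_one _ _

theorem val_infty_algebraMap_le {q : k[X]} {n : ℤ} (h : q ≠ 0 → (q.natDegree : ℤ) ≤ n) :
    val ∞ (ι q) ≤ WithZero.exp n := by
  by_cases hq : q = 0
  · simp [hq]
  · rw [val_infty_algebraMap hq, WithZero.exp_le_exp]
    exact h hq

/-- Up to sign, `t d/dt` is `s d/ds` for `s = 1/t`, so it does not lower orders at infinity. -/
theorem val_infty_X_mul_ddt_le (f : RatFunc k) : val ∞ (RatFunc.X * ddt f) ≤ val ∞ f := by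
  by_cases hf : f = 0
  · simp [hf]
  have hn : f.num ≠ 0 := RatFunc.num_ne_zero hf
  have hd : f.denom ≠ 0 := f.denom_ne_zero
  have h1 : ddt f = ddtFun f := rfl
  have h2 : val ∞ f = WithZero.exp ((f.num.natDegree : ℤ) - f.denom.natDegree) := by
    conv_lhs => rw [← RatFunc.num_div_denom f]
    rw [map_div₀, val_infty_algebraMap hn, val_infty_algebraMap hd, WithZero.exp_sub]
  have h3 : val ∞ (ι (X * (derivative f.num * f.denom - f.num * derivative f.denom)))
      ≤ WithZero.exp ((f.num.natDegree : ℤ) + f.denom.natDegree) := by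
    refine val_infty_algebraMap_le fun h0 => ?_
    have h4 : derivative f.num * f.denom - f.num * derivative f.denom ≠ 0 := right_ne_zero_of_mul h0
    rw [natDegree_X_mul h4]
    -- The inequality is strict because differentiation lowers degrees; this leaves room for the
    -- extra factor `X`.
    have h5 : (derivative f.num * f.denom - f.num * derivative f.denom).degree
        < ((f.num.natDegree + f.denom.natDegree : ℕ) : WithBot ℕ) := by
      have hc : ((f.num.natDegree + f.denom.natDegree : ℕ) : WithBot ℕ)
          = f.num.degree + f.denom.degree := by
        rw [degree_eq_natDegree hn, degree_eq_natDegree hd]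
        rfl
      rw [hc]
      refine (degree_sub_le _ _).trans_lt (max_lt ?_ ?_)
      · rw [degree_mul]
        exact WithBot.add_lt_add_right (by simpa using hd) (degree_derivative_lt hn)
      · rw [degree_mul]
        exact WithBot.add_lt_add_left (by simpa using hn) (degree_derivative_lt hd)
    have h6 := (natDegree_lt_iff_degree_lt h4).2 h5
    omega
  rw [h1, ddtFun, ← map_mul, ← map_mul, ← map_sub, ← mul_div_assoc, ← RatFunc.algebraMap_X,
    ← map_mul, map_div₀, map_pow, val_infty_algebraMap hd, h2, ← WithZero.exp_nsmul]
  refine div_le_of_le_mul₀ zero_le zero_le (h3.trans ?_)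
  rw [← WithZero.exp_add, WithZero.exp_le_exp]
  simp only [nsmul_eq_mul, Nat.cast_ofNat]
  linarith

theorem logGen_infty {S : Finset (OnePoint k)} (h : ∞ ∈ S) : logGen S ∞ = RatFunc.X := by
  simp [logGen, h]

theorem logGen_coe_of_mem {S : Finset (OnePoint k)} {a : k} (h : (a : OnePoint k) ∈ S) :
    logGen S (a : OnePoint k) = RatFunc.X - RatFunc.C a := by
  simp [logGen, h]

theorem logGen_coe_of_notMem {S : Finset (OnePoint k)} {a : k} (h : (a : OnePoint k) ∉ S) :
    logGen S (a : OnePoint k) = 1 := by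
  simp [logGen, h]

theorem logGen_ne_zero (S : Finset (OnePoint k)) (x : OnePoint k) : logGen S x ≠ 0 := by
  induction x using OnePoint.rec with
  | infty => simp only [logGen]; split_ifs <;> simp [RatFunc.X_ne_zero]
  | coe a =>
    by_cases h : (a : OnePoint k) ∈ S
    · rw [logGen_coe_of_mem h]; exact X_sub_C_ne_zero' a
    · rw [logGen_coe_of_notMem h]; exact one_ne_zero

theorem val_coe_logGen_le_one (S : Finset (OnePoint k)) (a : k) :
    val (a : OnePoint k) (logGen S a) ≤ 1 := by
  by_cases h : (a : OnePoint k) ∈ S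
  · rw [logGen_coe_of_mem h, X_sub_C_eq_algebraMap]; exact val_coe_algebraMap_le_one _ _
  · rw [logGen_coe_of_notMem h, map_one]

theorem val_logGen_mul_ddt_le_one {S : Finset (OnePoint k)} (hS : ∞ ∈ S) {x : OnePoint k}
    {f : RatFunc k} (h : val x f ≤ 1) : val x (logGen S x * ddt f) ≤ 1 := by
  induction x using OnePoint.rec with
  | infty => rw [logGen_infty hS]; exact (val_infty_X_mul_ddt_le f).trans h
  | coe a =>
    rw [map_mul]
    exact mul_le_one' (val_coe_logGen_le_one S a) (val_coe_ddt_le_one h)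

/-! ### The flat bundle of a second order operator -/

/-- The lattice in `k(t)²` over the local ring at `x` with basis `(c 0, 0)`, `(0, c 1)`. -/
def diagLattice (x : OnePoint k) (c : Fin 2 → RatFunc k) :
    Submodule (localRing x) (Fin 2 → RatFunc k) where
  carrier := {e | ∀ i, val x (e i) ≤ val x (c i)}
  add_mem' := fun ha hb i => (val x).map_add_le (ha i) (hb i)
  zero_mem' := fun i => by simp
  smul_mem' := fun r e he i => by
    have h : val x ((r • e) i) = val x (r : RatFunc k) * val x (e i) := by
      rw [← map_mul]; rfl
    rw [h]
    exact mul_le_of_le_one_of_le r.2 (he i)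

theorem mem_diagLattice {x : OnePoint k} {c e : Fin 2 → RatFunc k} :
    e ∈ diagLattice x c ↔ ∀ i, val x (e i) ≤ val x (c i) := Iff.rfl

theorem val_div_le_one {x : OnePoint k} {a c : RatFunc k} (h : val x a ≤ val x c) :
    val x (a / c) ≤ 1 := by
  rw [map_div₀]
  exact div_le_one_of_le₀ h zero_le

/-- The basis `(c 0, 0)`, `(0, c 1)` of `k(t)²`. -/
noncomputable def diagBasis (c : Fin 2 → RatFunc k) (hc : ∀ i, c i ≠ 0) :
    Module.Basis (Fin 2) (RatFunc k) (Fin 2 → RatFunc k) :=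
  (Pi.basisFun (RatFunc k) (Fin 2)).unitsSMul fun i => Units.mk0 (c i) (hc i)

theorem diagBasis_apply (c : Fin 2 → RatFunc k) (hc : ∀ i, c i ≠ 0) (i : Fin 2) :
    diagBasis c hc i = Pi.single i (c i) := by
  rw [diagBasis, Module.Basis.unitsSMul_apply, Pi.basisFun_apply, Units.smul_mk0,
    ← Pi.single_smul, smul_eq_mul, mul_one]

theorem diagLattice_eq_span (x : OnePoint k) (c : Fin 2 → RatFunc k) (hc : ∀ i, c i ≠ 0) :
    diagLattice x c = Submodule.span (localRing x) (Set.range (diagBasis c hc)) := by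
  apply le_antisymm
  · intro e he
    have h : e = ∑ i, (⟨e i / c i, val_div_le_one (he i)⟩ : localRing x) •
        diagBasis c hc i := by
      ext j
      rw [Finset.sum_apply, Finset.sum_eq_single j]
      · rw [Pi.smul_apply, diagBasis_apply, Pi.single_eq_same, Subring.smul_def, smul_eq_mul,
          div_mul_cancel₀ _ (hc j)]
      · intro i _ hij
        rw [Pi.smul_apply, diagBasis_apply, Pi.single_eq_of_ne hij.symm, smul_zero]
      · simp
    rw [h]
    exact Submodule.sum_mem _ fun i _ =>
      Submodule.smul_mem _ _ (Submodule.subset_span ⟨i, rfl⟩)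
  · rw [Submodule.span_le]
    rintro _ ⟨i, rfl⟩ j
    rw [diagBasis_apply]
    by_cases h : j = i
    · subst h; rw [Pi.single_eq_same]
    · rw [Pi.single_eq_of_ne h, map_zero]; exact zero_le

/-- The connection on `k(t)²` with cyclic vector `e₁ = (1, 0)`, `∇(d/dt) e₁ = e₂ = (0, 1)` and
`∇(d/dt) e₂ = - p₂ e₁ - p₁ e₂`. -/
noncomputable def companionNabla (p₁ p₂ : RatFunc k) : (Fin 2 → RatFunc k) →ₗ[k] (Fin 2 → RatFunc k) where
  toFun e := ![ddt (e 0) - p₂ * e 1, ddt (e 1) + e 0 - p₁ * e 1]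
  map_add' a b := by
    ext i
    fin_cases i <;> simp <;> ring
  map_smul' c a := by
    ext i
    fin_cases i <;> simp [smul_sub, smul_add]

theorem companionNabla_apply (p₁ p₂ : RatFunc k) (e : Fin 2 → RatFunc k) :
    companionNabla p₁ p₂ e = ![ddt (e 0) - p₂ * e 1, ddt (e 1) + e 0 - p₁ * e 1] := rfl

/-- Write `f = (f/c) c` with `f/c` regular and apply the Leibniz rule: a logarithmic field preserves
the lattice `c 𝒪_x` as soon as it maps the generator `c` into it. -/
theorem val_logGen_mul_ddt_le {S : Finset (OnePoint k)} (hS : ∞ ∈ S) {x : OnePoint k}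
    {f c : RatFunc k} (hc : c ≠ 0) (hcD : val x (logGen S x * ddt c) ≤ val x c)
    (h : val x f ≤ val x c) : val x (logGen S x * ddt f) ≤ val x c := by
  have h1 := val_logGen_mul_ddt_le_one hS (val_div_le_one h)
  have h2 : logGen S x * ddt f = f / c * (logGen S x * ddt c)
      + c * (logGen S x * ddt (f / c)) := by
    have h3 : ddt f = ddt (f / c * c) := by rw [div_mul_cancel₀ _ hc]
    rw [h3, Derivation.leibniz, smul_eq_mul, smul_eq_mul]
    ring
  rw [h2]
  refine (val x).map_add_le ?_ ?_
  · rw [map_mul]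
    exact mul_le_of_le_one_of_le (val_div_le_one h) hcD
  · rw [map_mul]
    exact mul_le_of_le_of_le_one le_rfl h1

/-- A second order operator `(d/dt)² + p₁ d/dt + p₂` which is regular singular in `S`, together with
local generators `s x` of a line bundle on `ℙ¹` that serves as Hodge filtration. -/
structure CompanionData (S : Finset (OnePoint k)) where
  infty_mem : ∞ ∈ S
  p₁ : RatFunc k
  p₂ : RatFunc k
  s : OnePoint k → RatFunc k
  s_ne_zero : ∀ x, s x ≠ 0
  s_coe : ∀ a : k, s a = 1
  s_log : ∀ x, val x (logGen S x * ddt (s x)) ≤ val x (s x)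
  val_p₁ : ∀ x, val x (logGen S x * p₁) ≤ 1
  val_p₂ : ∀ x, val x (logGen S x ^ 2 * p₂) ≤ 1

namespace CompanionData

variable {S : Finset (OnePoint k)} (A : CompanionData S)

/-- The local generators `s` and `s · logGen S` of the lattice at `x`. -/
noncomputable def gen (x : OnePoint k) : Fin 2 → RatFunc k := ![A.s x, A.s x * logGen S x]

theorem gen_ne_zero (x : OnePoint k) (i : Fin 2) : A.gen x i ≠ 0 := by
  fin_cases i
  · exact A.s_ne_zero x
  · exact mul_ne_zero (A.s_ne_zero x) (logGen_ne_zero S x)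

theorem val_ddt_logGen (hS : ∞ ∈ S) (x : OnePoint k) : val x (ddt (logGen S x)) ≤ 1 := by
  induction x using OnePoint.rec with
  | infty => rw [logGen_infty hS, ddt_X, map_one]
  | coe a => exact val_coe_ddt_le_one (val_coe_logGen_le_one S a)

/-- The factor `logGen` in the second generator balances the orders: it absorbs the one produced by
`e₁ ↦ e₂`, and supplies the second factor needed against a double pole of `p₂`. -/
theorem log_regular {x : OnePoint k} {e : Fin 2 → RatFunc k} (he : e ∈ diagLattice x (A.gen x)) :
    logGen S x • companionNabla A.p₁ A.p₂ e ∈ diagLattice x (A.gen x) := by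
  have h0 : val x (e 0) ≤ val x (A.s x) := he 0
  have h1 : val x (e 1) ≤ val x (A.s x * logGen S x) := he 1
  have hg : val x (logGen S x * ddt (A.s x * logGen S x)) ≤ val x (A.s x * logGen S x) := by
    rw [Derivation.leibniz, smul_eq_mul, smul_eq_mul]
    have : logGen S x * (A.s x * ddt (logGen S x) + logGen S x * ddt (A.s x))
      = A.s x * logGen S x * ddt (logGen S x) + logGen S x * ddt (A.s x) * logGen S x := by ring
    rw [this]
    refine (val x).map_add_le ?_ ?_
    · rw [map_mul]
      exact mul_le_of_le_of_le_one le_rfl (val_ddt_logGen A.infty_mem x)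
    · rw [map_mul, map_mul (val x) (A.s x)]
      exact mul_le_mul_left (A.s_log x) _
  rw [mem_diagLattice, Fin.forall_fin_two]
  constructor
  · change val x (logGen S x * (ddt (e 0) - A.p₂ * e 1)) ≤ val x (A.s x)
    rw [mul_sub]
    refine (val x).map_sub_le (val_logGen_mul_ddt_le A.infty_mem (A.s_ne_zero x) (A.s_log x) h0) ?_
    have h2 := A.val_p₂ x
    rw [mul_left_comm, map_mul, map_mul]
    rw [map_mul, map_pow] at h2
    rw [map_mul] at h1
    calc val x A.p₂ * (val x (logGen S x) * val x (e 1))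
        ≤ val x A.p₂ * (val x (logGen S x) * (val x (A.s x) * val x (logGen S x))) := by gcongr
      _ = val x (A.s x) * (val x (logGen S x) ^ 2 * val x A.p₂) := by
        rw [pow_two]; ac_rfl
      _ ≤ val x (A.s x) := mul_le_of_le_of_le_one le_rfl h2
  · change val x (logGen S x * (ddt (e 1) + e 0 - A.p₁ * e 1)) ≤ val x (A.s x * logGen S x)
    rw [mul_sub, mul_add]
    refine (val x).map_sub_le ((val x).map_add_le
      (val_logGen_mul_ddt_le A.infty_mem (A.gen_ne_zero x 1) hg h1) ?_) ?_
    · rw [map_mul, map_mul, mul_comm]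
      exact mul_le_mul_left h0 _
    · rw [← mul_assoc, map_mul]
      exact mul_le_of_le_one_of_le (A.val_p₁ x) h1

/-- The flat bundle of the operator `(d/dt)² + p₁ d/dt + p₂`. -/
noncomputable def bundle : FlatBundle S where
  stalk x := diagLattice x (A.gen x)
  locally_free x := ⟨_, diagLattice_eq_span x _ (A.gen_ne_zero x)⟩
  coherent := by
    -- Outside `S`, which contains infinity, both `s` and `logGen` equal `1`, so the standard basis
    -- works.
    refine ⟨diagBasis (fun _ => 1) fun _ => one_ne_zero, ?_⟩
    filter_upwards [S.finite_toSet.compl_mem_cofinite] with x hx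
    rw [← diagLattice_eq_span]
    congr 1
    induction x using OnePoint.rec with
    | infty => exact absurd A.infty_mem hx
    | coe a =>
      have h : logGen S (a : OnePoint k) = 1 := logGen_coe_of_notMem hx
      ext i
      fin_cases i <;> simp [gen, A.s_coe, h]
  nabla := companionNabla A.p₁ A.p₂
  leibniz f e := by
    ext i
    fin_cases i <;> simp [companionNabla_apply] <;> ring
  log_regular _ _ he := A.log_regular he

theorem mem_stalk {x : OnePoint k} {e : Fin 2 → RatFunc k} : e ∈ A.bundle.stalk x ↔
    val x (e 0) ≤ val x (A.s x) ∧ val x (e 1) ≤ val x (A.s x * logGen S x) :=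
  Fin.forall_fin_two

theorem nabla_apply (e : Fin 2 → RatFunc k) :
    A.bundle.nabla e = ![ddt (e 0) - A.p₂ * e 1, ddt (e 1) + e 0 - A.p₁ * e 1] := rfl

theorem val_lt_of_mem_maxStalk {x : OnePoint k} {e : Fin 2 → RatFunc k}
    (he : e ∈ A.bundle.maxStalk x) (i : Fin 2) : val x (e i) < val x (A.gen x i) := by
  have hpos : 0 < val x (A.gen x i) := by
    rw [zero_lt_iff, Valuation.ne_zero_iff]
    exact A.gen_ne_zero x i
  induction he using Submodule.span_induction with
  | mem e he =>
    obtain ⟨f, hf, e', he', rfl⟩ := he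
    rw [Pi.smul_apply, smul_eq_mul, map_mul]
    exact (mul_le_mul_right (he' i) _).trans_lt (mul_lt_of_lt_one_left hpos hf)
  | zero => simpa using hpos
  | add a b _ _ ha hb => exact (val x).map_add_lt ha hb
  | smul r e _ he =>
    rw [Pi.smul_apply, Subring.smul_def, smul_eq_mul, map_mul]
    exact (mul_le_of_le_one_left zero_le r.2).trans_lt he

/-- The residue sends `s e₁` to a vector whose `e₂`-coordinate is exactly the local generator `s ·
logGen`, hence is nonzero in the fibre. -/
theorem nontrivialMonodromy (x : OnePoint k) : A.bundle.NontrivialMonodromy x := by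
  refine ⟨![A.s x, 0], A.mem_stalk.2 ⟨le_rfl, by simp⟩, fun h => ?_⟩
  have h1 := A.val_lt_of_mem_maxStalk h 1
  simp [nabla_apply, gen, mul_comm] at h1

/-- The generic fibre of the Hodge filtration. -/
noncomputable def fil (k : Type*) [Field k] : Submodule (RatFunc k) (Fin 2 → RatFunc k) :=
  Submodule.span (RatFunc k) {![1, 0]}

theorem mem_fil {e : Fin 2 → RatFunc k} : e ∈ fil k ↔ e 1 = 0 := by
  rw [fil, Submodule.mem_span_singleton]
  constructor
  · rintro ⟨c, rfl⟩; simp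
  · intro h
    refine ⟨e 0, ?_⟩
    ext i
    fin_cases i <;> simp [h]

/-- Modulo `e₁` only the `e₂`-coordinate survives, and there the map is multiplication by `logGen`,
which carries the generator `s` to the generator `s · logGen`. -/
theorem isHodgeFiltration : A.bundle.IsHodgeFiltration (fil k) := by
  refine ⟨finrank_span_singleton fun h => one_ne_zero (congrFun h 0), fun x => ⟨?_, ?_⟩⟩
  · rw [injective_iff_map_eq_zero]
    rintro ⟨e, heF, hes⟩ h
    have h1 := (Submodule.Quotient.mk_eq_zero _).1 h
    have h2 : (logGen S x • A.bundle.nabla e) 1 = 0 := mem_fil.1 h1.1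
    have h3 : e 1 = 0 := mem_fil.1 heF
    have h4 : e 0 = 0 := by
      simpa [nabla_apply, h3, logGen_ne_zero] using h2
    ext i
    fin_cases i
    · exact h4
    · exact h3
  · intro w
    obtain ⟨⟨w, hw⟩, rfl⟩ := Submodule.Quotient.mk_surjective _ w
    have hg := logGen_ne_zero S x
    have hg' : 0 < val x (logGen S x) := by rwa [zero_lt_iff, Valuation.ne_zero_iff]
    have hw1 := (A.mem_stalk.1 hw).2
    have he : (![w 1 / logGen S x, 0] : Fin 2 → RatFunc k) ∈ A.bundle.filStalk (fil k) x := by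
      refine ⟨mem_fil.2 (by simp), A.mem_stalk.2 ⟨?_, by simp⟩⟩
      rw [map_mul] at hw1
      simpa [div_le_iff₀ hg'] using hw1
    refine ⟨⟨_, he⟩, ?_⟩
    refine (Submodule.Quotient.eq _).2 ?_
    refine ⟨mem_fil.2 ?_, Submodule.sub_mem _ (A.bundle.log_regular x _ he.2) hw⟩
    simp [nabla_apply, mul_div_cancel₀ _ hg]

theorem isIndigenous : A.bundle.IsIndigenous :=
  ⟨⟨_, A.isHodgeFiltration⟩, fun x _ => A.nontrivialMonodromy x⟩

theorem isAssociatedOperator : A.bundle.IsAssociatedOperator (fil k) A.p₁ A.p₂ := by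
  refine ⟨![1, 0], fun a => ?_, ?_⟩
  · ext e
    rw [Submodule.mem_span_singleton]
    constructor
    · rintro ⟨heF, hes⟩
      have h0 := (A.mem_stalk.1 hes).1
      rw [A.s_coe, map_one] at h0
      have h1 : e 1 = 0 := mem_fil.1 heF
      refine ⟨⟨e 0, h0⟩, ?_⟩
      ext i
      fin_cases i <;> simp [h1, Subring.smul_def]
    · rintro ⟨c, rfl⟩
      refine ⟨mem_fil.2 (by simp), A.mem_stalk.2 ⟨?_, by simp⟩⟩
      rw [A.s_coe, map_one]
      have hc : val (a : OnePoint k) (c : RatFunc k) ≤ 1 := c.2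
      rw [Pi.smul_apply, Subring.smul_def, smul_eq_mul]
      exact (mul_one (c : RatFunc k)).symm ▸ hc
  · ext i
    fin_cases i <;> simp [nabla_apply]

/-- The functional `e₁ ↦ u`, `e₂ ↦ u'` defined by a solution `u` of the operator. -/
noncomputable def functional (u : RatFunc k) : (Fin 2 → RatFunc k) →ₗ[RatFunc k] RatFunc k :=
  u • LinearMap.proj 0 + ddt u • LinearMap.proj 1

theorem functional_apply (u : RatFunc k) (e : Fin 2 → RatFunc k) :
    functional u e = u * e 0 + ddt u * e 1 := rfl

/-- Horizontality amounts to the differential equation for `u`. The values of the functional on the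
two local generators are `s u` and `s · logGen · u'`; surjectivity needs one of them to be a unit.
-/
theorem isNormalization {u : RatFunc k} (hu : ddt (ddt u) + A.p₁ * ddt u + A.p₂ * u = 0)
    (h0 : ∀ x, val x (A.s x * u) ≤ 1) (h1 : ∀ x, val x (A.s x * logGen S x * ddt u) ≤ 1)
    (h : ∀ x, val x (A.s x * u) = 1 ∨ val x (A.s x * logGen S x * ddt u) = 1) :
    A.bundle.IsNormalization (functional u) := by
  refine ⟨fun e => ?_, fun x => ?_⟩
  · simp only [functional_apply, nabla_apply, map_add, Derivation.leibniz, smul_eq_mul,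
      Matrix.cons_val_zero, Matrix.cons_val_one]
    linear_combination (-e 1) * hu
  · ext f
    constructor
    · rintro ⟨e, he, rfl⟩
      obtain ⟨he0, he1⟩ := A.mem_stalk.1 he
      refine (val x).map_add_le ?_ ?_
      · refine le_trans ?_ (h0 x)
        rw [LinearMap.smul_apply, smul_eq_mul, LinearMap.proj_apply, map_mul, map_mul, mul_comm]
        exact mul_le_mul_left he0 _
      · refine le_trans ?_ (h1 x)
        rw [LinearMap.smul_apply, smul_eq_mul, LinearMap.proj_apply, map_mul,
          map_mul _ (A.s x * logGen S x), mul_comm]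
        exact mul_le_mul_left he1 _
    · intro hf
      have hf : val x f ≤ 1 := hf
      -- If a generator `c eᵢ` has unit value `c v`, then `(f/v) eᵢ` lies in the lattice and maps to
      -- `f`.
      have aux : ∀ {c v : RatFunc k}, val x (c * v) = 1 →
          v * (f / v) = f ∧ val x (f / v) ≤ val x c := by
        intro c v hcv
        have hv : v ≠ 0 := by
          rintro rfl
          simp at hcv
        refine ⟨mul_div_cancel₀ _ hv, ?_⟩
        have hv' : 0 < val x v := by rwa [zero_lt_iff, Valuation.ne_zero_iff]
        rw [map_div₀, div_le_iff₀ hv', ← map_mul, hcv]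
        exact hf
      rcases h x with h | h
      · obtain ⟨h2, h3⟩ := aux h
        exact ⟨![f / u, 0], A.mem_stalk.2 ⟨h3, by simp⟩, by simp [functional_apply, h2]⟩
      · obtain ⟨h2, h3⟩ := aux h
        exact ⟨![0, f / ddt u], A.mem_stalk.2 ⟨by simp, h3⟩, by simp [functional_apply, h2]⟩

end CompanionData

/-! ### The `p`-curvature in presence of a horizontal functional -/

namespace FlatBundle

variable {S : Finset (OnePoint k)} (E : FlatBundle S)

theorem smul_nabla_pow_horizontal {δ : Fin 2 → RatFunc k} (hδ : E.nabla δ = 0)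
    (h b : RatFunc k) (n : ℕ) :
    ((h • E.nabla) ^ n) (b • δ) = (fun f => h * ddt f)^[n] b • δ := by
  induction n generalizing b with
  | zero => rfl
  | succ n ih =>
    rw [pow_succ, Module.End.mul_apply, Function.iterate_succ_apply, ← ih]
    congr 1
    rw [LinearMap.smul_apply, E.leibniz, hδ, smul_zero, add_zero, smul_smul]

theorem functional_smul_nabla_pow {γ : (Fin 2 → RatFunc k) →ₗ[RatFunc k] RatFunc k}
    (hγ : ∀ e, γ (E.nabla e) = ddt (γ e)) (h : RatFunc k) (e : Fin 2 → RatFunc k) (n : ℕ) :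
    γ (((h • E.nabla) ^ n) e) = (fun f => h * ddt f)^[n] (γ e) := by
  induction n generalizing e with
  | zero => rfl
  | succ n ih =>
    rw [pow_succ, Module.End.mul_apply, Function.iterate_succ_apply, ih, LinearMap.smul_apply,
      _root_.map_smul, hγ, smul_eq_mul]

/-- The `p`-curvature vanishes on the trivial connections `𝒪 δ` and `𝒪`. Hence `Ψ` kills `ker γ` and
has its image there, so `Ψ² = 0`. -/
theorem hasNilpotentPCurvature_of_horizontal (p : ℕ) [Fact p.Prime] [CharP k p]
    {γ : (Fin 2 → RatFunc k) →ₗ[RatFunc k] RatFunc k} (hγ : ∀ e, γ (E.nabla e) = ddt (γ e))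
    {δ : Fin 2 → RatFunc k} (hδ : E.nabla δ = 0) (hker : ∀ e, γ e = 0 → ∃ b : RatFunc k, e = b • δ) :
    E.HasNilpotentPCurvature p := by
  intro h
  have h1 : ∀ e, γ (E.pCurvature p h e) = 0 := by
    intro e
    rw [pCurvature, LinearMap.sub_apply, LinearMap.smul_apply, map_sub, _root_.map_smul, hγ,
      E.functional_smul_nabla_pow hγ, iterate_derivation_eq, smul_eq_mul, sub_self]
  have h2 : ∀ b : RatFunc k, E.pCurvature p h (b • δ) = 0 := by
    intro b
    rw [pCurvature, LinearMap.sub_apply, LinearMap.smul_apply, E.smul_nabla_pow_horizontal hδ,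
      iterate_derivation_eq, E.leibniz, hδ, smul_zero, add_zero, smul_smul, sub_self]
  refine ⟨2, LinearMap.ext fun e => ?_⟩
  obtain ⟨b, hb⟩ := hker _ (h1 e)
  rw [pow_two, Module.End.mul_apply, hb, h2, LinearMap.zero_apply]

theorem pCurvature_one_apply {p : ℕ} (hp : 2 ≤ p) {e δ : Fin 2 → RatFunc k} {f : RatFunc k}
    (hδ : E.nabla δ = 0) (he : E.nabla e = f • δ) :
    E.pCurvature p 1 e = (fun f => ddt f)^[p - 1] f • δ := by
  have h0 : (fun f : RatFunc k => (1 : RatFunc k) * ddt f) = fun f => ddt f := by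
    funext f; rw [one_mul]
  have hX : ∀ n, (fun f : RatFunc k => ddt f)^[n] 0 = 0 := fun n => by
    induction n with
    | zero => rfl
    | succ n ih => rw [Function.iterate_succ_apply, map_zero, ih]
  -- Two applications of `D` already annihilate `t`, so `D^p = 0` and the correction term
  -- disappears.
  obtain ⟨n, rfl⟩ : ∃ n, p = n + 1 + 1 := ⟨p - 2, by omega⟩
  have h1 := E.smul_nabla_pow_horizontal hδ 1 f (n + 1)
  rw [h0] at h1
  rw [pCurvature, LinearMap.sub_apply, LinearMap.smul_apply, h0, Function.iterate_succ_apply,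
    Function.iterate_succ_apply, ddt_X, Derivation.map_one_eq_zero, hX,
    zero_smul, sub_zero, pow_succ, Module.End.mul_apply, LinearMap.smul_apply, he, one_smul _ (f • δ)]
  exact h1

end FlatBundle

/-! ### Finite sets of points containing `∞` -/

theorem infty_mem_marked {K : Type*} (T : Finset K) : ∞ ∈ marked T := by
  simp [marked]

theorem coe_mem_marked {K : Type*} {T : Finset K} {a : K} : (a : OnePoint K) ∈ marked T ↔ a ∈ T := by
  simp [marked]

theorem exists_eq_marked {K : Type*} {M : Finset (OnePoint K)} (h : ∞ ∈ M) : ∃ N : Finset K, M = marked N := by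
  classical
  refine ⟨M.preimage (fun a : K => (a : OnePoint K)) OnePoint.coe_injective.injOn, ?_⟩
  ext x
  induction x using OnePoint.rec with
  | infty => simp [h, infty_mem_marked]
  | coe a => simp [coe_mem_marked]

theorem sum_marked {K : Type*} (N : Finset K) (f : OnePoint K → ℤ) :
    ∑ x ∈ marked N, f x = f ∞ + ∑ a ∈ N, f a := by
  classical
  rw [marked, Finset.sum_insert (by simp), Finset.sum_image OnePoint.coe_injective.injOn]

/-! ### The coefficient `p₁` -/

theorem Qfun_ne_zero (T : Finset k) (α : OnePoint k → ℕ) : Qfun T α ≠ 0 :=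
  Finset.prod_ne_zero_iff.2 fun a _ => zpow_ne_zero _ (X_sub_C_ne_zero' a)

theorem ddt_X_sub_C_zpow (a : k) (n : ℤ) : ddt ((RatFunc.X - RatFunc.C a) ^ n)
    = (n : RatFunc k) / (RatFunc.X - RatFunc.C a) * (RatFunc.X - RatFunc.C a) ^ n := by
  have h := X_sub_C_ne_zero' a
  rw [Derivation.leibniz_zpow, ddt_X_sub_C, zpow_sub_one₀ h]
  simp only [smul_eq_mul, zsmul_eq_mul, mul_one]
  ring

theorem ddt_prod_X_sub_C_zpow (T : Finset k) (n : k → ℤ) :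
    ddt (∏ a ∈ T, (RatFunc.X - RatFunc.C a) ^ n a)
      = (∑ a ∈ T, (n a : RatFunc k) / (RatFunc.X - RatFunc.C a)) *
        ∏ a ∈ T, (RatFunc.X - RatFunc.C a) ^ n a := by
  classical
  induction T using Finset.induction_on with
  | empty => simp
  | insert a s ha ih =>
    rw [Finset.prod_insert ha, Finset.sum_insert ha, Derivation.leibniz, ih, ddt_X_sub_C_zpow]
    simp only [smul_eq_mul]
    ring

theorem val_intCast_le_one (n : ℤ) (x : OnePoint k) : val x (n : RatFunc k) ≤ 1 := by
  rw [← map_intCast (RatFunc.C : k →+* RatFunc k)]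
  exact val_C_le_one _ x

theorem val_coe_le_one_of_mul_lt_one {a : k} {f : RatFunc k}
    (h : val (a : OnePoint k) ((RatFunc.X - RatFunc.C a) * f) < 1) :
    val (a : OnePoint k) f ≤ 1 := by
  by_cases hf : f = 0
  · simp [hf]
  rw [map_mul, val_coe_X_sub_C] at h
  have h0 : val (a : OnePoint k) f ≠ 0 := (Valuation.ne_zero_iff _).2 hf
  rw [← WithZero.exp_log h0, ← WithZero.exp_add, ← WithZero.exp_zero, WithZero.exp_lt_exp] at h
  rw [← WithZero.exp_log h0, ← WithZero.exp_zero, WithZero.exp_le_exp]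
  omega

theorem val_infty_lt_one_of_X_mul_le_one {f : RatFunc k} (h : val ∞ (RatFunc.X * f) ≤ 1) :
    val ∞ f < 1 := by
  by_cases hf : f = 0
  · simp [hf]
  rw [map_mul, val_infty_X] at h
  have h0 : val ∞ f ≠ 0 := (Valuation.ne_zero_iff _).2 hf
  rw [← WithZero.exp_log h0, ← WithZero.exp_add, ← WithZero.exp_zero, WithZero.exp_le_exp] at h
  rw [← WithZero.exp_log h0, ← WithZero.exp_zero, WithZero.exp_lt_exp]
  omega

/-- A zero exponent forces `B = 0`; evaluating the indicial polynomial at `1` then gives the residue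
of `p₁`. -/
theorem RegularSingularAt.hasValue_of_exponent_zero {p₁ p₂ : RatFunc k} {a ρ : k}
    (h : RegularSingularAt p₁ p₂ a ρ 0) :
    HasValue (a : OnePoint k) ((RatFunc.X - RatFunc.C a) * p₁) (1 - ρ) := by
  obtain ⟨A, B, hA, -, hAB⟩ := h
  have h0 := congrArg (eval 0) hAB
  have h1 := congrArg (eval 1) hAB
  simp only [eval_add, eval_mul, eval_X, eval_sub, eval_C, eval_one] at h0 h1
  have : A = 1 - ρ := by linear_combination h1 - h0
  rwa [← this]

/-- A function on `ℙ¹` with at most simple poles in `T ∪ {∞}` and prescribed residues on `T` is a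
logarithmic derivative. -/
theorem ddt_Qfun [IsAlgClosed k] (T : Finset k) (α : OnePoint k → ℕ) (p₁ : RatFunc k)
    (hreg : ∀ a ∉ T, val (a : OnePoint k) p₁ ≤ 1)
    (hfin : ∀ a ∈ T, HasValue (a : OnePoint k) ((RatFunc.X - RatFunc.C a) * p₁)
      (1 - (α (a : OnePoint k) : k)))
    (hinf : val ∞ (RatFunc.X * p₁) ≤ 1) :
    ddt (Qfun T α) = p₁ * Qfun T α := by
  classical
  rw [Qfun, ddt_prod_X_sub_C_zpow]
  congr 1
  rw [← sub_eq_zero]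
  have hterm : ∀ (a b : k) (n : ℤ), a ≠ b →
      val (a : OnePoint k) ((n : RatFunc k) / (RatFunc.X - RatFunc.C b)) ≤ 1 := by
    intro a b n hab
    rw [map_div₀, val_coe_X_sub_C_of_ne hab, div_one]
    exact val_intCast_le_one n _
  -- On the affine line the residues cancel, leaving no poles. At infinity both terms have order at
  -- least one, so the difference vanishes there.
  apply eq_zero_of_val
  · intro a
    by_cases ha : a ∈ T
    · rw [← Finset.add_sum_erase T _ ha, add_sub_right_comm]
      refine (val _).map_add_le ?_ ?_
      · apply val_coe_le_one_of_mul_lt_one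
        have h1 := hfin a ha
        rw [HasValue, Valuation.map_sub_swap] at h1
        rw [mul_sub, mul_div_cancel₀ _ (X_sub_C_ne_zero' a)]
        convert h1 using 3
        simp
      · exact (val _).map_sum_le fun b hb => hterm a b _ (Finset.ne_of_mem_erase hb).symm
    · refine (val _).map_sub_le ?_ (hreg a ha)
      exact (val _).map_sum_le fun b hb => hterm a b _ fun h => ha (h ▸ hb)
  · apply val_infty_lt_one_of_X_mul_le_one
    rw [mul_sub, Finset.mul_sum]
    refine (val _).map_sub_le ((val _).map_sum_le fun b _ => ?_) hinf
    rw [← mul_div_assoc, map_div₀, map_mul, val_infty_X, val_infty_X_sub_C, mul_comm,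
      mul_div_cancel_right₀ _ WithZero.exp_ne_zero]
    exact val_intCast_le_one _ _

/-! ### The horizontal section in the kernel of the functional -/

namespace CompanionData

variable {S : Finset (OnePoint k)} (A : CompanionData S)

/-- The vector is proportional to `(-u', u)`, so `functional u` kills it. The factor `Q`, an inverse
Wronskian by Abel's formula, makes it horizontal. -/
theorem nabla_kernel_eq_zero {Q u : RatFunc k} (hQ : ddt Q = A.p₁ * Q)
    (hu : ddt (ddt u) + A.p₁ * ddt u + A.p₂ * u = 0) :
    A.bundle.nabla ![-(Q * ddt u), Q * u] = 0 := by
  ext i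
  fin_cases i
  · simp [nabla_apply, hQ]
    linear_combination (-Q) * hu
  · simp [nabla_apply, hQ]
    ring

/-- Since `γ(e₀) = 1`, the derivative of `e₀` lies in `ker γ`. The coefficient found here is the
function to which `dualFun` applies `D^{p-1}`. -/
theorem nabla_canonical {Q u : RatFunc k} (hQ : Q ≠ 0) (hu : u ≠ 0) :
    A.bundle.nabla ![u⁻¹, 0] = (1 / (Q * u ^ 2)) • ![-(Q * ddt u), Q * u] := by
  ext i
  fin_cases i
  · simp [nabla_apply, Derivation.leibniz_inv]
    field_simp
  · simp [nabla_apply]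
    field_simp

theorem eq_smul_of_functional_eq_zero {Q u : RatFunc k} (hQ : Q ≠ 0) (hu : u ≠ 0)
    {e : Fin 2 → RatFunc k} (he : functional u e = 0) :
    ∃ b : RatFunc k, e = b • ![-(Q * ddt u), Q * u] := by
  rw [functional_apply] at he
  refine ⟨e 1 / (Q * u), ?_⟩
  ext i
  fin_cases i
  · simp
    field_simp
    linear_combination he
  · simp
    field_simp

end CompanionData

/-- Generators of the line bundle `𝒪(d)` on `ℙ¹`. -/
noncomputable def twistGen (d : ℕ) : OnePoint k → RatFunc k
  | ∞ => (RatFunc.X ^ d)⁻¹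
  | OnePoint.some _ => 1

theorem twistGen_coe (d : ℕ) (a : k) : twistGen d (a : OnePoint k) = 1 := rfl

theorem twistGen_infty (d : ℕ) : twistGen d (∞ : OnePoint k) = (RatFunc.X ^ d)⁻¹ := rfl

theorem ordEq_twistGen_infty (d : ℕ) : OrdEq ∞ (twistGen d (∞ : OnePoint k)) d := by
  simpa [twistGen_infty] using (ordEq_infty_X (k := k).pow d).inv

/-- The data attached to an operator with regular singularities in `T ∪ {∞}`. -/
noncomputable def companionDataOfRegularSingular (T : Finset k) (d : ℕ) (p₁ p₂ : RatFunc k)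
    (hreg : ∀ a ∉ T, val (a : OnePoint k) p₁ ≤ 1 ∧ val (a : OnePoint k) p₂ ≤ 1)
    (hfin : ∀ a ∈ T, ∃ ρ₁ ρ₂, RegularSingularAt p₁ p₂ a ρ₁ ρ₂)
    (hinf : ∃ ρ₁ ρ₂, RegularSingularAtInfty p₁ p₂ ρ₁ ρ₂) : CompanionData (marked T) where
  infty_mem := infty_mem_marked T
  p₁ := p₁
  p₂ := p₂
  s := twistGen d
  s_ne_zero x := by
    induction x using OnePoint.rec with
    | infty => exact inv_ne_zero (pow_ne_zero _ RatFunc.X_ne_zero)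
    | coe a => exact one_ne_zero
  s_coe _ := rfl
  s_log x := by
    induction x using OnePoint.rec with
    | infty => rw [logGen_infty (infty_mem_marked T)]; exact val_infty_X_mul_ddt_le _
    | coe a => simp [twistGen_coe]
  val_p₁ x := by
    induction x using OnePoint.rec with
    | infty =>
      obtain ⟨_, _, A, B, hA, hB, -⟩ := hinf
      rw [logGen_infty (infty_mem_marked T)]
      exact hA.val_le_one
    | coe a =>
      by_cases ha : a ∈ T
      · obtain ⟨_, _, A, B, hA, hB, -⟩ := hfin a ha
        rw [logGen_coe_of_mem (coe_mem_marked.2 ha)]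
        exact hA.val_le_one
      · rw [logGen_coe_of_notMem (mt coe_mem_marked.1 ha), one_mul]
        exact (hreg a ha).1
  val_p₂ x := by
    induction x using OnePoint.rec with
    | infty =>
      obtain ⟨_, _, A, B, hA, hB, -⟩ := hinf
      rw [logGen_infty (infty_mem_marked T)]
      exact hB.val_le_one
    | coe a =>
      by_cases ha : a ∈ T
      · obtain ⟨_, _, A, B, hA, hB, -⟩ := hfin a ha
        rw [logGen_coe_of_mem (coe_mem_marked.2 ha)]
        exact hB.val_le_one
      · rw [logGen_coe_of_notMem (mt coe_mem_marked.1 ha), one_pow, one_mul]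
        exact (hreg a ha).2

/-! ### The polynomial `u` as a surjective functional -/

theorem val_twistGen_mul_le_one (u : k[X]) (x : OnePoint k) :
    val x (twistGen u.natDegree x * ι u) ≤ 1 := by
  by_cases hu : u = 0
  · simp [hu]
  induction x using OnePoint.rec with
  | infty =>
    have h := (ordEq_twistGen_infty u.natDegree).mul (ordEq_infty_algebraMap hu)
    rw [add_neg_cancel] at h
    exact (ordEq_zero_iff.1 h).le
  | coe a => rw [twistGen_coe, one_mul]; exact val_coe_algebraMap_le_one a u

theorem val_twistGen_mul_logGen_mul_ddt_le_one (T : Finset k) (u : k[X]) (x : OnePoint k) :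
    val x (twistGen u.natDegree x * logGen (marked T) x * ddt (ι u)) ≤ 1 := by
  rw [mul_assoc, map_mul]
  induction x using OnePoint.rec with
  | infty =>
    refine le_trans ?_ (val_twistGen_mul_le_one u ∞)
    rw [map_mul _ _ (ι u), logGen_infty (infty_mem_marked T)]
    exact mul_le_mul_right (val_infty_X_mul_ddt_le (ι u)) _
  | coe a =>
    rw [twistGen_coe, map_one, one_mul]
    exact val_logGen_mul_ddt_le_one (infty_mem_marked T) (val_coe_algebraMap_le_one a u)

/-- At a zero of `u` the derivative is a unit by separability, and `logGen` is `1` because no zero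
is marked. At infinity the twist by `deg u` makes `u` a unit. -/
theorem val_twistGen_mul_eq_one_or {T : Finset k} {u : k[X]} (hu : u.Separable)
    (hT : ∀ a ∈ T, ¬ u.IsRoot a) (x : OnePoint k) :
    val x (twistGen u.natDegree x * ι u) = 1 ∨
      val x (twistGen u.natDegree x * logGen (marked T) x * ddt (ι u)) = 1 := by
  induction x using OnePoint.rec with
  | infty =>
    have h := (ordEq_twistGen_infty u.natDegree).mul (ordEq_infty_algebraMap hu.ne_zero)
    rw [add_neg_cancel] at h
    exact Or.inl (ordEq_zero_iff.1 h)
  | coe a =>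
    simp only [twistGen_coe, one_mul]
    by_cases ha : u.IsRoot a
    · right
      rw [logGen_coe_of_notMem (mt coe_mem_marked.1 fun h => hT a h ha), one_mul, ddt_algebraMap]
      exact val_coe_algebraMap_eq_one (not_isRoot_derivative hu ha)
    · exact Or.inl (val_coe_algebraMap_eq_one ha)

/-- At infinity `1/u` has the order of the generator `t^{-deg u}`, so poles come only from the
finite zeros of `u`, which are simple. -/
theorem CompanionData.hasSimplePole_iff {T : Finset k} (A : CompanionData (marked T)) {u : k[X]}
    (hs : A.s = twistGen u.natDegree) (hu : u.Separable) (x : OnePoint k) :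
    A.bundle.HasSimplePole ![(ι u)⁻¹, 0] x ↔ ∃ a : k, x = (a : OnePoint k) ∧ u.IsRoot a := by
  constructor
  · rintro ⟨h, -⟩
    by_contra hx
    apply h
    rw [A.mem_stalk, hs]
    refine ⟨?_, by simp⟩
    change val x (ι u)⁻¹ ≤ _
    induction x using OnePoint.rec with
    | infty =>
      have h1 := (ordEq_infty_algebraMap hu.ne_zero).inv
      rw [neg_neg] at h1
      exact (h1.trans (ordEq_twistGen_infty u.natDegree).symm).le
    | coe a =>
      have ha : ¬ u.IsRoot a := fun ha => hx ⟨a, rfl, ha⟩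
      rw [map_inv₀, val_coe_algebraMap_eq_one ha, twistGen_coe, map_one, inv_one]
  · rintro ⟨a, rfl, ha⟩
    have h1 := ordEq_coe_algebraMap_of_isRoot hu ha
    have h2 : OrdEq (a : OnePoint k) (RatFunc.X - RatFunc.C a) 1 := val_coe_X_sub_C a
    refine ⟨fun h => ?_, RatFunc.X - RatFunc.C a, h2, ?_⟩
    · have h3 : val (a : OnePoint k) (ι u)⁻¹ ≤ val (a : OnePoint k) (A.s a) := (A.mem_stalk.1 h).1
      have h4 : val (a : OnePoint k) (ι u)⁻¹ = _ := h1.inv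
      rw [h4, A.s_coe, map_one, ← WithZero.exp_zero, WithZero.exp_le_exp] at h3
      omega
    · refine A.mem_stalk.2 ⟨?_, by simp⟩
      have h3 := ordEq_zero_iff.1 (h2.mul h1.inv)
      rw [A.s_coe, map_one]
      exact h3.le

/-! ### The signature -/

theorem tensorOrdEq_coe {a : k} {v : RatFunc k} {n : ℕ} {m : ℤ} :
    TensorOrdEq (a : OnePoint k) v n m ↔ OrdEq (a : OnePoint k) v m := by
  simp [TensorOrdEq, logGen]

/-- The shift by `2n` arises because `d/dt` has a double zero at infinity. -/
theorem tensorOrdEq_infty {v : RatFunc k} {n : ℕ} {m : ℤ} (h : OrdEq ∞ v m) :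
    TensorOrdEq ∞ v n (m + 2 * n) := by
  have h1 : OrdEq ∞ (logGen (∅ : Finset (OnePoint k)) ∞ ^ n) (-2 * n) := by
    have := (ordEq_infty_X (k := k).pow 2).pow n
    simp only [logGen, Finset.notMem_empty, if_false]
    convert this using 1
    push_cast
    ring
  have h2 := h.div h1
  rw [TensorOrdEq]
  convert h2 using 1
  ring

/-- The order at `∞` of a rational function, if its zeros and poles lie in `N` and in the zeros of a
separable polynomial `u`, where it has double poles. -/
theorem ordEq_infty_of_coe [IsAlgClosed k] {v : RatFunc k} {u : k[X]} (hu : u.Separable)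
    (N : Finset k) (m : k → ℤ) (hroot : ∀ a, u.IsRoot a → a ∉ N ∧ OrdEq (a : OnePoint k) v (-2))
    (hN : ∀ a ∈ N, OrdEq (a : OnePoint k) v (m a))
    (hother : ∀ a ∉ N, ¬ u.IsRoot a → OrdEq (a : OnePoint k) v 0) :
    OrdEq ∞ v (2 * u.natDegree - ∑ a ∈ N, m a) := by
  classical
  set P : RatFunc k := ∏ b ∈ N, (RatFunc.X - RatFunc.C b) ^ m b with hP
  have hU : ι u ≠ 0 := RatFunc.algebraMap_ne_zero hu.ne_zero
  -- Multiplication by `u²` removes the double poles and division by `P` the orders on `N`; what is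
  -- left is constant.
  have h1 : OrdEq ∞ (v / P * ι u ^ 2) 0 := by
    apply ordEq_infty_zero
    intro a
    have hPa := ordEq_coe_prod_X_sub_C_zpow a N m
    by_cases ha : u.IsRoot a
    · obtain ⟨haN, hv⟩ := hroot a ha
      rw [if_neg haN] at hPa
      simpa using (hv.div hPa).mul ((ordEq_coe_algebraMap_of_isRoot hu ha).pow 2)
    · have hUa := (ordEq_coe_algebraMap_of_not_isRoot ha).pow 2
      by_cases haN : a ∈ N
      · rw [if_pos haN] at hPa
        simpa using ((hN a haN).div hPa).mul hUa
      · rw [if_neg haN] at hPa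
        simpa using ((hother a haN ha).div hPa).mul hUa
  have hP' := ordEq_infty_prod_X_sub_C_zpow N m
  have h2 := (h1.mul hP').div ((ordEq_infty_algebraMap hu.ne_zero).pow 2)
  have h3 : v / P * ι u ^ 2 * P / ι u ^ 2 = v := by
    have hP0 : P ≠ 0 := hP'.ne_zero
    field_simp
  rw [← hP, h3] at h2
  convert h2 using 1
  push_cast
  ring

end ProjLine

/-! ### The bundle of `L` and its invariants -/

theorem proposition5p4 {k : Type*} [Field k] [IsAlgClosed k] (p : ℕ) [Fact p.Prime] [CharP k p]
    (hp : p ≠ 2)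
    -- the marked points: `T` is the set of finite ones, and `x_r = ∞`
    (T : Finset k) (hT : 3 ≤ (ProjLine.marked T).card)
    -- the signature, whose singularities are the marked points
    (σ : ProjLine.Signature k p)
    (hσ : ∀ x, σ.IsSingularity x ↔ x ∈ ProjLine.marked T)
    -- `0 ≤ α_i < p` and `σ_i ≡ α_i mod p`
    (α : OnePoint k → ℕ)
    (hα : ∀ x ∈ ProjLine.marked T,
      α x < p ∧ σ.num x ≡ (α x : ℤ) * ((p : ℤ) - 1) [ZMOD p])
    -- the operator `L`
    (p₁ p₂ : RatFunc k)
    (hreg : ∀ a ∉ T, ProjLine.val (a : OnePoint k) p₁ ≤ 1 ∧ ProjLine.val (a : OnePoint k) p₂ ≤ 1)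
    (hfin : ∀ a ∈ T, ProjLine.RegularSingularAt p₁ p₂ a (α (a : OnePoint k) : k) 0)
    (hinf : ProjLine.RegularSingularAtInfty p₁ p₂
      (-(σ.d : k) + (α OnePoint.infty : k)) (-(σ.d : k)))
    -- the polynomial solution `u`
    (u : Polynomial k) (hdeg : u.natDegree = σ.d)
    (hsol : ProjLine.ddt (ProjLine.ddt (algebraMap (Polynomial k) (RatFunc k) u))
      + p₁ * ProjLine.ddt (algebraMap (Polynomial k) (RatFunc k) u)
      + p₂ * algebraMap (Polynomial k) (RatFunc k) u = 0)
    (hsimple : u.Separable)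
    (hmarked : ∀ a ∈ T, ¬ u.IsRoot a)
    -- the orders of `D^{p-1}(1/(Qu²))` at the finite points
    (hord_ss : ∀ a : k, u.IsRoot a →
      ProjLine.OrdEq (a : OnePoint k) (ProjLine.dualFun p T α u) 0)
    (hord_marked : ∀ a ∈ T,
      ProjLine.OrdEq (a : OnePoint k) (ProjLine.dualFun p T α u)
        (σ.num (a : OnePoint k) + (α (a : OnePoint k) : ℤ) - p))
    (hord_spike : ∀ a ∉ T, (a : OnePoint k) ∈ σ.M →
      ProjLine.OrdEq (a : OnePoint k) (ProjLine.dualFun p T α u)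
        (σ.num (a : OnePoint k) - ((p : ℤ) - 1)))
    (hord_other : ∀ a ∉ T, ¬ u.IsRoot a → (a : OnePoint k) ∉ σ.M →
      ProjLine.OrdEq (a : OnePoint k) (ProjLine.dualFun p T α u) 0) :
    ∃ (E : ProjLine.FlatBundle (ProjLine.marked T))
      (F : Submodule (RatFunc k) (Fin 2 → RatFunc k))
      (γ : (Fin 2 → RatFunc k) →ₗ[RatFunc k] RatFunc k) (e₀ : Fin 2 → RatFunc k),
      E.IsIndigenous ∧ E.IsActive p ∧ E.HasNilpotentPCurvature p ∧ E.IsNormalized ∧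
      E.IsCanonicalSection F γ e₀ ∧
      E.IsAssociatedOperator F p₁ p₂ ∧
      E.HasSignature p e₀ σ ∧
      ∀ x : OnePoint k, E.HasSimplePole e₀ x ↔ ∃ a : k, x = (a : OnePoint k) ∧ u.IsRoot a := by
  open ProjLine in
  classical
  have hMarkedM : ∀ x ∈ marked T, x ∈ σ.M := fun x hx => ((hσ x).2 hx).1
  have hU : algebraMap k[X] (RatFunc k) u ≠ 0 := RatFunc.algebraMap_ne_zero hsimple.ne_zero
  have hQ0 : Qfun T α ≠ 0 := Qfun_ne_zero T α
  have hQ : ddt (Qfun T α) = p₁ * Qfun T α := by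
    refine ddt_Qfun T α p₁ (fun a ha => (hreg a ha).1)
      (fun a ha => (hfin a ha).hasValue_of_exponent_zero) ?_
    obtain ⟨_, _, hA, -, -⟩ := hinf
    exact hA.val_le_one
  let A : CompanionData (marked T) := companionDataOfRegularSingular T u.natDegree p₁ p₂ hreg
    (fun a ha => ⟨_, _, hfin a ha⟩) ⟨_, _, hinf⟩
  let U : RatFunc k := algebraMap k[X] (RatFunc k) u
  let δ : Fin 2 → RatFunc k := ![-(Qfun T α * ddt U), Qfun T α * U]
  have hδ : A.bundle.nabla δ = 0 := A.nabla_kernel_eq_zero hQ hsol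
  have he₀ : A.bundle.nabla ![U⁻¹, 0] = (1 / (Qfun T α * U ^ 2)) • δ := A.nabla_canonical hQ0 hU
  have hnorm : A.bundle.IsNormalization (CompanionData.functional U) :=
    A.isNormalization hsol (val_twistGen_mul_le_one u)
      (val_twistGen_mul_logGen_mul_ddt_le_one T u) (val_twistGen_mul_eq_one_or hsimple hmarked)
  have hΨ : A.bundle.pCurvature p 1 ![U⁻¹, 0] = dualFun p T α u • δ :=
    A.bundle.pCurvature_one_apply (Fact.out : p.Prime).two_le hδ he₀
  -- Any finite point would do: a prescribed order at one point already excludes the zero function.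
  have hf : dualFun p T α u ≠ 0 := by
    by_cases h : u.IsRoot 0
    · exact (hord_ss 0 h).ne_zero
    · by_cases h0 : (0 : k) ∈ T
      · exact (hord_marked 0 h0).ne_zero
      · by_cases h1 : ((0 : k) : OnePoint k) ∈ σ.M
        · exact (hord_spike 0 h0 h1).ne_zero
        · exact (hord_other 0 h0 h h1).ne_zero
  refine ⟨A.bundle, CompanionData.fil k, CompanionData.functional U, ![U⁻¹, 0],
    A.isIndigenous, ⟨1, fun h => ?_⟩,
    A.bundle.hasNilpotentPCurvature_of_horizontal p hnorm.1 hδ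
      fun e he => CompanionData.eq_smul_of_functional_eq_zero hQ0 hU he,
    ⟨_, hnorm⟩,
    ⟨A.isHodgeFiltration, hnorm, CompanionData.mem_fil.2 (by simp),
      by simp [CompanionData.functional_apply, U, hU]⟩,
    A.isAssociatedOperator, ?_, A.hasSimplePole_iff rfl hsimple⟩
  · rw [h] at hΨ
    have h1 := congrFun hΨ 1
    have h2 : (0 : RatFunc k) = dualFun p T α u * (Qfun T α * U) := h1
    exact mul_ne_zero hf (mul_ne_zero hQ0 hU) h2.symm
  -- Solving `∇e₀ = -v Ψ(e₀)` with `Ψ(e₀) = f δ` and `∇e₀ = (1/(Qu²)) δ` gives this `v`.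
  · set v : RatFunc k := -(1 / (Qfun T α * U ^ 2) / dualFun p T α u) with hv
    refine ⟨v, ?_, ?_⟩
    · rw [hΨ, he₀, smul_neg, smul_smul, hv, neg_mul, neg_smul, neg_neg, div_mul_cancel₀ _ hf]
    have hQa : ∀ a : k, OrdEq (a : OnePoint k) (Qfun T α)
        (if a ∈ T then 1 - (α (a : OnePoint k) : ℤ) else 0) :=
      fun a => ordEq_coe_prod_X_sub_C_zpow a T _
    have hvord : ∀ (a : k) (q w f : ℤ), OrdEq (a : OnePoint k) (Qfun T α) q →
        OrdEq (a : OnePoint k) U w → OrdEq (a : OnePoint k) (dualFun p T α u) f →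
        OrdEq (a : OnePoint k) v (-q - 2 * w - f) := by
      intro a q w f hq hw hf
      have h := ((hq.mul (hw.pow 2)).inv.div hf).neg
      rw [inv_eq_one_div] at h
      rw [hv]
      convert h using 1
      push_cast
      ring
    have hroot : ∀ a : k, u.IsRoot a →
        (a : OnePoint k) ∉ σ.M ∧ OrdEq (a : OnePoint k) v (-2) := by
      intro a ha
      have haT : a ∉ T := fun h => hmarked a h ha
      refine ⟨fun haM => ?_, ?_⟩
      -- At a zero of `u` in `M` the two prescribed orders of `f` would force `σ_x = 1`, which is
      -- excluded.
      · have h := (hord_spike a haT haM).unique (hord_ss a ha)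
        exact σ.ne_one _ haM (by omega)
      · have h := hQa a
        rw [if_neg haT] at h
        exact hvord a _ _ _ h (ordEq_coe_algebraMap_of_isRoot hsimple ha) (hord_ss a ha)
    have hM : ∀ a : k, (a : OnePoint k) ∈ σ.M →
        OrdEq (a : OnePoint k) v ((p : ℤ) - 1 - σ.num (a : OnePoint k)) := by
      intro a haM
      have ha : ¬ u.IsRoot a := fun h => (hroot a h).1 haM
      have hUa := ordEq_coe_algebraMap_of_not_isRoot ha
      have h := hQa a
      by_cases haT : a ∈ T
      · rw [if_pos haT] at h
        convert hvord a _ _ _ h hUa (hord_marked a haT) using 1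
        ring
      · rw [if_neg haT] at h
        convert hvord a _ _ _ h hUa (hord_spike a haT haM) using 1
        ring
    have hother : ∀ a : k, (a : OnePoint k) ∉ σ.M → ¬ u.IsRoot a →
        OrdEq (a : OnePoint k) v 0 := by
      intro a haM ha
      have haT : a ∉ T := fun h => haM (hMarkedM _ (coe_mem_marked.2 h))
      have h := hQa a
      rw [if_neg haT] at h
      exact hvord a _ _ _ h (ordEq_coe_algebraMap_of_not_isRoot ha) (hord_other a haT ha haM)
    obtain ⟨N, hN⟩ := exists_eq_marked (hMarkedM _ (infty_mem_marked T))
    have hmem : ∀ a : k, (a : OnePoint k) ∈ σ.M ↔ a ∈ N := fun a => by rw [hN, coe_mem_marked]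
    intro x
    induction x using OnePoint.rec with
    | infty =>
      refine ⟨σ.num ∞, ?_, fun _ => rfl, fun h => absurd (hMarkedM _ (infty_mem_marked T)) h⟩
      have h1 := ordEq_infty_of_coe hsimple N _
        (fun a ha => ⟨fun h => (hroot a ha).1 ((hmem a).2 h), (hroot a ha).2⟩)
        (fun a ha => hM a ((hmem a).2 ha)) (fun a ha => hother a fun h => ha ((hmem a).1 h))
      -- The order at infinity is `2d - ∑_N (p-1-num) + 2(p-1)`; the equation for `2d` turns it into
      -- `p-1-num ∞`.
      convert tensorOrdEq_infty (n := p - 1) h1 using 1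
      have h2 := σ.two_mul_d
      rw [hN, sum_marked] at h2
      have h3 : ∑ a ∈ N, ((p : ℤ) - 1 - σ.num (a : OnePoint k))
          = -∑ a ∈ N, (σ.num (a : OnePoint k) - ((p : ℤ) - 1)) := by
        rw [← Finset.sum_neg_distrib]
        exact Finset.sum_congr rfl fun a _ => by ring
      rw [hdeg, h3, Nat.cast_pred (Fact.out : p.Prime).pos]
      linarith
    | coe a =>
      by_cases haM : (a : OnePoint k) ∈ σ.M
      · exact ⟨_, tensorOrdEq_coe.2 (hM a haM), fun _ => rfl, fun h => absurd haM h⟩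
      · by_cases ha : u.IsRoot a
        -- The double pole of `v` coming from `u²` corresponds to `σ_x = (p+1)/(p-1)`.
        · refine ⟨(p : ℤ) + 1, tensorOrdEq_coe.2 ?_, fun h => absurd h haM, fun _ => Or.inr rfl⟩
          convert (hroot a ha).2 using 1
          ring
        · refine ⟨(p : ℤ) - 1, tensorOrdEq_coe.2 ?_, fun h => absurd h haM, fun _ => Or.inl rfl⟩
          convert hother a haM ha using 1
          ring
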